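/- **Definitions.** For elements $a,b$ of a bounded distributive lattice write $a\triangleleft b$ if there is $c$ with $a\wedge c=0$ and $b\vee c=1$. A frame $L$ is *compact* if every directed subset with join $1$ contains $1$, and *regular* if $b=\bigvee\{a\mid a\triangleleft b\}$ for all $b\in L$. $\mathbf{KRegFrm}$ is the category of compact regular frames and frame homomorphisms. Locales form the opposite of the category of frames; a locale $X$ is compact Hausdorff if its frame of opens $\mathcal O X$ is compact and its diagonal is a closed sublocale of $X\times X$, and $\mathbf{KHausLoc}$ is the category of compact Hausdorff locales. These notions are also interpreted in the internal logic of the presheaf topos $\hat{\mathcal C}=[\mathcal C^{op},\mathbf{Set}]$ of a small category $\mathcal C$, which gives the categories $\mathbf{KRegFrm}_{\hat{\mathcal C}}$ and $\mathbf{KHausLoc}_{\hat{\mathcal C}}$; an internal frame has in particular an underlying presheaf of bounded distributive lattices $L:\mathcal C^{op}\to\mathbf{DLat}$. For a bounded distributive lattice $N$ let $C(N)$ be the poset, ordered by inclusion, of the ideals $I\subseteq N$ such that for every $a\in I$ there is $b\in I$ with $a\triangleleft b$; a lattice homomorphism $f:N\to M$ induces $C(f):C(N)\to C(M)$, $I\mapsto\{y\mid\exists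 x\in I,\ y\le f(x)\}$. For a functor $A:\mathcal C^{op}\to\mathbf{Pos}$ let $\tilde A:\mathcal C^{op}\to\mathbf{Pos}$ be $$\tilde A(a)=\Big\{(x_f)_f\in\prod_{f:b\to a}A(b)\ \Big|\ A(g)x_f\le x_{fg}\ \text{ for all } c\xrightarrow{g}b\xrightarrow{f}a\Big\},\qquad \big(\tilde A(h)(x)\big)_{f}=x_{hf},$$ with the pointwise order; a natural transformation $\phi:A\to B$ induces $\tilde\phi:\tilde A\to\tilde B$, $\tilde\phi(x)_f=\phi(x_f)$. **Theorem.** For any small category $\mathcal C$ there is an equivalence of categories $$\mathbf{KRegFrm}_{\hat{\mathcal C}}\simeq[\mathcal C^{op},\mathbf{KRegFrm}]$$ which sends an internal compact regular frame $L$ to $C\circ L$, and whose inverse sends $A:\mathcal C^{op}\to\mathbf{KRegFrm}$ to $\tilde A$; that is, on underlying presheaves of posets the two functors of the equivalence are naturally isomorphic to $L\mapsto C\circ L$ and $A\mapsto\tilde A$. Dually, there is an equivalence of categories $$\mathbf{KHausLoc}_{\hat{\mathcal C}}\simeq[\mathcal C,\mathbf{KHausLoc}],$$ given on frames of opens, in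 the same sense, by the same two constructions. -/

import Mathlib

open CategoryTheory Opposite

universe u

namespace PresheafFrame

/-! ### Compact regular frames and compact Hausdorff locales over sets -/

/-- `a ◁ b`: there is `c` with `a ∧ c = 0` and `b ∨ c = 1`. -/
def WellInside {N : Type u} [Lattice N] [BoundedOrder N] (a b : N) : Prop :=
  ∃ c : N, a ⊓ c = ⊥ ∧ b ⊔ c = ⊤

/-- A frame is regular if every element is the join of the elements well inside it. -/
def IsRegularFrame (L : Type u) [Order.Frame L] : Prop :=
  ∀ b : L, b = sSup {a : L | WellInside a b}

/-- The category of compact regular frames and frame homomorphisms. -/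
abbrev KRegFrm : Type (u + 1) :=
  ObjectProperty.FullSubcategory
    (fun L : Frm.{u} => IsCompactElement (⊤ : L) ∧ IsRegularFrame L)

/-- The elements of the frame coproduct `L ⊗ L`, i.e. the opens of the product locale `X × X` when
`L = O(X)`: lower sets of `L × L` that are closed under arbitrary (also empty) joins in each
variable separately. -/
structure IsProductOpen {L : Type u} [Order.Frame L] (W : Set (L × L)) : Prop where
  lower : IsLowerSet W
  sSup_left : ∀ (S : Set L) (y : L), (∀ x ∈ S, (x, y) ∈ W) → (sSup S, y) ∈ W
  sSup_right : ∀ (x : L) (S : Set L), (∀ y ∈ S, (x, y) ∈ W) → (x, sSup S) ∈ W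

/-- The locale of `L` is Hausdorff: its diagonal is a closed sublocale. The right adjoint of the
codiagonal `L ⊗ L → L` sends `a` to `{(x, y) | x ∧ y ≤ a}`, so the diagonal, as a subset of
`L ⊗ L`, consists of the opens of this form; its closure consists of all the opens which contain
the least one of these, `{(x, y) | x ∧ y = 0}`. -/
def IsHausdorffFrame (L : Type u) [Order.Frame L] : Prop :=
  ∀ W : Set (L × L), IsProductOpen W → (∀ x y : L, x ⊓ y = ⊥ → (x, y) ∈ W) →
    ∃ a : L, ∀ x y : L, (x, y) ∈ W ↔ x ⊓ y ≤ a

/-- The category of compact Hausdorff locales, a full subcategory of the category of locales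
(the opposite of the category of frames). -/
abbrev KHausLoc : Type (u + 1) :=
  ObjectProperty.FullSubcategory
    (fun X : Locale.{u} => IsCompactElement (⊤ : X) ∧ IsHausdorffFrame X)

/-! ### Subsets and joins in the internal logic of the presheaf topos

An internal bounded distributive lattice of the presheaf topos is a functor `Cᵒᵖ ⥤ BddDistLat`.
The statements about it that follow are the Kripke-Joyal translations, at a stage `c`, of the
usual statements of the theory of frames. -/

section Internal

variable {C : Type u} [SmallCategory C]

/-- Restriction along `f : b ⟶ c`. -/
abbrev res (L : Cᵒᵖ ⥤ BddDistLat.{u}) {b c : C} (f : b ⟶ c) :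
    BoundedLatticeHom (L.obj (op c)) (L.obj (op b)) :=
  (L.map f.op).hom

lemma res_id (L : Cᵒᵖ ⥤ BddDistLat.{u}) {c : C} (x : L.obj (op c)) : res L (𝟙 c) x = x := by
  simp [res]

lemma res_comp (L : Cᵒᵖ ⥤ BddDistLat.{u}) {b c d : C} (g : d ⟶ b) (f : b ⟶ c)
    (x : L.obj (op c)) : res L (g ≫ f) x = res L g (res L f x) := by
  simp [res]

lemma app_res {L M : Cᵒᵖ ⥤ BddDistLat.{u}} (φ : L ⟶ M) {b c : C} (f : b ⟶ c)
    (x : L.obj (op c)) : φ.app (op b) (res L f x) = res M f (φ.app (op c) x) :=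
  ConcreteCategory.congr_hom (φ.naturality f.op) x

/-- A subset of `L` at stage `c`, i.e. an element at `c` of the power object of `L`: a subfunctor of
`C(-, c) × L`. -/
@[ext]
structure SubsetAt (L : Cᵒᵖ ⥤ BddDistLat.{u}) (c : C) where
  mem : ∀ {b : C}, (b ⟶ c) → Set (L.obj (op b))
  mem_res : ∀ {b d : C} (f : b ⟶ c) (g : d ⟶ b) {x : L.obj (op b)},
    x ∈ mem f → res L g x ∈ mem (g ≫ f)

/-- A binary relation on `L` at stage `c`: a subfunctor of `C(-, c) × L × L`. -/
structure RelAt (L : Cᵒᵖ ⥤ BddDistLat.{u}) (c : C) where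
  mem : ∀ {b : C}, (b ⟶ c) → Set (L.obj (op b) × L.obj (op b))
  mem_res : ∀ {b d : C} (f : b ⟶ c) (g : d ⟶ b) {x y : L.obj (op b)},
    (x, y) ∈ mem f → (res L g x, res L g y) ∈ mem (g ≫ f)

namespace SubsetAt

variable {L M N : Cᵒᵖ ⥤ BddDistLat.{u}} {c : C}

/-- `s` is the join of `S`, internally: `s` is an upper bound of `S`, and it is below every upper
bound of `S` at every later stage. -/
def IsJoin (S : SubsetAt L c) (s : L.obj (op c)) : Prop :=
  (∀ {b : C} (f : b ⟶ c) (y : L.obj (op b)), y ∈ S.mem f → y ≤ res L f s) ∧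
  ∀ {b : C} (f : b ⟶ c) (x : L.obj (op b)),
    (∀ {d : C} (g : d ⟶ b) (y : L.obj (op d)), y ∈ S.mem (g ≫ f) → y ≤ res L g x) →
      res L f s ≤ x

/-- The subset `{a ∧ y | y ∈ S}`. -/
def meetWith (a : L.obj (op c)) (S : SubsetAt L c) : SubsetAt L c where
  mem f := {z | ∃ y ∈ S.mem f, z = res L f a ⊓ y}
  mem_res f g := by
    rintro _ ⟨y, hy, rfl⟩
    exact ⟨res L g y, S.mem_res f g hy, by rw [map_inf, res_comp]⟩

/-- The direct image `{φ y | y ∈ S}`. -/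
def image (φ : L ⟶ M) (S : SubsetAt L c) : SubsetAt M c where
  mem {b} f := {z | ∃ y ∈ S.mem f, φ.app (op b) y = z}
  mem_res f g := by
    rintro _ ⟨y, hy, rfl⟩
    exact ⟨res L g y, S.mem_res f g hy, app_res φ g y⟩

lemma image_id (S : SubsetAt L c) : S.image (𝟙 L) = S := by
  ext b f x
  simp [image]

lemma image_comp (φ : L ⟶ M) (ψ : M ⟶ N) (S : SubsetAt L c) :
    S.image (φ ≫ ψ) = (S.image φ).image ψ := by
  ext b f x
  simp [image]

/-- The subset `{a | a ◁ b}`. -/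
def wellInside (b : L.obj (op c)) : SubsetAt L c where
  mem f := {a | WellInside a (res L f b)}
  mem_res f g := by
    rintro x ⟨y, hy, hy'⟩
    refine ⟨res L g y, ?_, ?_⟩
    · rw [← map_inf, hy, map_bot]
    · rw [res_comp, ← map_sup, hy', map_top]

/-- `S` is inhabited and any two of its elements have an upper bound in it, internally. -/
def IsDirected (S : SubsetAt L c) : Prop :=
  ∀ {b : C} (f : b ⟶ c), (S.mem f).Nonempty ∧ DirectedOn (· ≤ ·) (S.mem f)

end SubsetAt

/-! ### Frames and locales in the presheaf topos -/

/-- An internal bounded distributive lattice is an internal frame if internally every subset has a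
join and binary meets distribute over arbitrary joins. -/
structure IsInternalFrame (L : Cᵒᵖ ⥤ BddDistLat.{u}) : Prop where
  exists_join : ∀ {c : C} (S : SubsetAt L c), ∃ s, S.IsJoin s
  meet_join : ∀ {c : C} (a : L.obj (op c)) (S : SubsetAt L c) (s : L.obj (op c)),
    S.IsJoin s → (S.meetWith a).IsJoin (a ⊓ s)

/-- Internally, every directed subset with join `1` has `1` as an element. -/
def IsInternallyCompact (L : Cᵒᵖ ⥤ BddDistLat.{u}) : Prop :=
  ∀ {c : C} (S : SubsetAt L c), S.IsDirected → S.IsJoin ⊤ → ⊤ ∈ S.mem (𝟙 c)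

/-- Internally, every `b` is the join of `{a | a ◁ b}`. -/
def IsInternallyRegular (L : Cᵒᵖ ⥤ BddDistLat.{u}) : Prop :=
  ∀ {c : C} (b : L.obj (op c)), (SubsetAt.wellInside b).IsJoin b

/-- The internal version of `IsProductOpen` at stage `c`. -/
structure RelAt.IsProductOpen {L : Cᵒᵖ ⥤ BddDistLat.{u}} {c : C} (W : RelAt L c) : Prop where
  lower : ∀ {b : C} (f : b ⟶ c), IsLowerSet (W.mem f)
  join_left : ∀ {b : C} (f : b ⟶ c) (S : SubsetAt L b) (s y : L.obj (op b)), S.IsJoin s →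
    (∀ {d : C} (g : d ⟶ b) (x : L.obj (op d)), x ∈ S.mem g → (x, res L g y) ∈ W.mem (g ≫ f)) →
      (s, y) ∈ W.mem f
  join_right : ∀ {b : C} (f : b ⟶ c) (S : SubsetAt L b) (s x : L.obj (op b)), S.IsJoin s →
    (∀ {d : C} (g : d ⟶ b) (y : L.obj (op d)), y ∈ S.mem g → (res L g x, y) ∈ W.mem (g ≫ f)) →
      (x, s) ∈ W.mem f

/-- The internal version of `IsHausdorffFrame`: the diagonal is a closed sublocale. -/
def IsInternallyHausdorff (L : Cᵒᵖ ⥤ BddDistLat.{u}) : Prop :=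
  ∀ {c : C} (W : RelAt L c), W.IsProductOpen →
    (∀ {b : C} (f : b ⟶ c) (x y : L.obj (op b)), x ⊓ y = ⊥ → (x, y) ∈ W.mem f) →
      ∃ a : L.obj (op c), ∀ {b : C} (f : b ⟶ c) (x y : L.obj (op b)),
        (x, y) ∈ W.mem f ↔ x ⊓ y ≤ res L f a

variable (C) in
/-- Frames in the topos of presheaves on `C`. -/
structure IntFrm where
  lat : Cᵒᵖ ⥤ BddDistLat.{u}
  isFrame : IsInternalFrame lat

/-- Internal frame homomorphisms: internal lattice homomorphisms (preserving `0` and `1`) which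
internally preserve arbitrary joins. -/
@[ext]
structure IntFrm.Hom (L M : IntFrm C) where
  hom : L.lat ⟶ M.lat
  map_join : ∀ {c : C} (S : SubsetAt L.lat c) (s : L.lat.obj (op c)),
    S.IsJoin s → (S.image hom).IsJoin (hom.app (op c) s)

instance : Category (IntFrm C) where
  Hom := IntFrm.Hom
  id L := ⟨𝟙 _, fun S s h => by simpa [SubsetAt.image_id] using h⟩
  comp φ ψ := ⟨φ.hom ≫ ψ.hom, fun S s h => by
    rw [SubsetAt.image_comp]
    simpa using ψ.map_join _ _ (φ.map_join _ _ h)⟩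

variable (C)

/-- The underlying presheaf of lattices of an internal frame. -/
def IntFrm.toLat : IntFrm C ⥤ (Cᵒᵖ ⥤ BddDistLat.{u}) where
  obj L := L.lat
  map φ := φ.hom

/-- The category of compact regular frames in the topos of presheaves on `C`. -/
abbrev IntKRegFrm : Type (u + 1) :=
  ObjectProperty.FullSubcategory
    (fun L : IntFrm C => IsInternallyCompact L.lat ∧ IsInternallyRegular L.lat)

/-- The category of compact Hausdorff locales in the topos of presheaves on `C`, a full subcategory
of the category of internal locales (the opposite of the category of internal frames). -/
abbrev IntKHausLoc : Type (u + 1) :=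
  ObjectProperty.FullSubcategory
    (fun X : (IntFrm C)ᵒᵖ => IsInternallyCompact X.unop.lat ∧ IsInternallyHausdorff X.unop.lat)

end Internal

/-! ### Underlying posets -/

/-- The underlying poset of a bounded distributive lattice. -/
def latToPos : BddDistLat.{u} ⥤ PartOrd.{u} where
  obj N := PartOrd.of N
  map f := PartOrd.ofHom (f.hom : _ →o _)

/-- The underlying poset of a frame. -/
def frmToPos : Frm.{u} ⥤ PartOrd.{u} where
  obj L := PartOrd.of L
  map f := PartOrd.ofHom (f.hom : _ →o _)

/-- The underlying poset of a compact regular frame. -/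
def KRegFrm.toPos : KRegFrm.{u} ⥤ PartOrd.{u} :=
  ObjectProperty.ι _ ⋙ frmToPos

/-- The poset of opens of a compact Hausdorff locale. -/
def KHausLoc.opens : KHausLoc.{u} ⥤ PartOrd.{u}ᵒᵖ where
  obj X := op (PartOrd.of X.obj)
  map f := (frmToPos.map (Quiver.Hom.unop (V := Frm.{u}) f.hom)).op

/-- The presheaf of lattices underlying a compact regular frame of the presheaf topos. -/
def IntKRegFrm.toLat (C : Type u) [SmallCategory C] :
    IntKRegFrm C ⥤ (Cᵒᵖ ⥤ BddDistLat.{u}) :=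
  ObjectProperty.ι _ ⋙ IntFrm.toLat C

/-- The presheaf of lattices of opens of a compact Hausdorff locale of the presheaf topos. -/
def IntKHausLoc.opens (C : Type u) [SmallCategory C] :
    IntKHausLoc C ⥤ (Cᵒᵖ ⥤ BddDistLat.{u})ᵒᵖ :=
  ObjectProperty.ι _ ⋙ (IntFrm.toLat C).op

/-! ### The completion of normal distributive lattices by rounded ideals -/

section Completion

/-- The poset, ordered by inclusion, of the ideals `I` of `N` such that each `a ∈ I` has some
`b ∈ I` with `a ◁ b`. -/
abbrev Completion (N : Type u) [Lattice N] [BoundedOrder N] : Type u :=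
  {I : Order.Ideal N // ∀ a ∈ I, ∃ b ∈ I, WellInside a b}

/-- `I ↦ ↓ f(I)`. -/
def Completion.map {N M : Type u} [Lattice N] [BoundedOrder N] [Lattice M] [BoundedOrder M]
    (f : BoundedLatticeHom N M) : Completion N →o Completion M where
  toFun I := ⟨
    { carrier := {y | ∃ x ∈ I.1, y ≤ f x}
      lower' := fun _ _ h ⟨x, hx, hy⟩ => ⟨x, hx, h.trans hy⟩
      nonempty' := let ⟨x, hx⟩ := I.1.nonempty; ⟨f x, x, hx, le_rfl⟩
      directed' := by
        rintro y ⟨x, hx, hy⟩ y' ⟨x', hx', hy'⟩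
        exact ⟨f (x ⊔ x'), ⟨_, Order.Ideal.sup_mem hx hx', le_rfl⟩,
          hy.trans (OrderHomClass.mono f le_sup_left),
          hy'.trans (OrderHomClass.mono f le_sup_right)⟩ }, by
      rintro y ⟨x, hx, hy⟩
      obtain ⟨b, hb, c, h0, h1⟩ := I.2 x hx
      refine ⟨f b, ⟨b, hb, le_rfl⟩, f c, ?_, ?_⟩
      · refine le_bot_iff.1 ((inf_le_inf_right _ hy).trans ?_)
        rw [← map_inf, h0, map_bot]
      · rw [← map_sup, h1, map_top]⟩
  monotone' := fun _ _ h _ ⟨x, hx, hy⟩ => ⟨x, h hx, hy⟩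

lemma Completion.mem_map {N M : Type u} [Lattice N] [BoundedOrder N] [Lattice M] [BoundedOrder M]
    (f : BoundedLatticeHom N M) (I : Completion N) (y : M) :
    y ∈ (Completion.map f I).1 ↔ ∃ x ∈ I.1, y ≤ f x :=
  Iff.rfl

/-- The completion `C(N)` as a functor to posets. -/
def completion : BddDistLat.{u} ⥤ PartOrd.{u} where
  obj N := PartOrd.of (Completion N)
  map f := PartOrd.ofHom (Completion.map f.hom)
  map_id N := by
    refine PartOrd.ext fun I => Subtype.ext (Order.Ideal.ext (Set.ext fun y => ?_))
    exact ⟨fun ⟨x, hx, hy⟩ => I.1.lower hy hx, fun hy => ⟨y, hy, le_rfl⟩⟩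
  map_comp f g := by
    refine PartOrd.ext fun I => Subtype.ext (Order.Ideal.ext (Set.ext fun y => ?_))
    constructor
    · rintro ⟨x, hx, hy⟩
      exact ⟨f x, ⟨x, hx, le_rfl⟩, hy⟩
    · rintro ⟨z, ⟨x, hx, hz⟩, hy⟩
      exact ⟨x, hx, hy.trans (OrderHomClass.mono g.hom hz)⟩

end Completion

/-! ### The lax-to-ordinary construction -/

section Tilde

variable {C : Type u} [SmallCategory C]

/-- The families `(x_f)` with `x_f ∈ F(b)` for `f : b ⟶ a` and `F(g) x_f ≤ x_{fg}` for all
composable `g : c ⟶ b` and `f : b ⟶ a`, with the pointwise order: the lax limit of `F` over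
`(C/a)ᵒᵖ`. -/
abbrev Tilde (F : Cᵒᵖ ⥤ PartOrd.{u}) (a : C) : Type u :=
  {x : ∀ (b : C), (b ⟶ a) → F.obj (op b) //
    ∀ (b c : C) (g : c ⟶ b) (f : b ⟶ a), F.map g.op (x b f) ≤ x c (g ≫ f)}

/-- `F̃(h)(x)_f = x_{hf}` for `h : a' ⟶ a`. -/
def Tilde.res (F : Cᵒᵖ ⥤ PartOrd.{u}) {a a' : C} (h : a' ⟶ a) : Tilde F a →o Tilde F a' where
  toFun x := ⟨fun b f => x.1 b (f ≫ h), fun b c g f => by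
    simpa using x.2 b c g (f ≫ h)⟩
  monotone' := fun _ _ hxy b f => hxy b (f ≫ h)

/-- `φ̃(x)_f = φ(x_f)`. -/
def Tilde.map {F G : Cᵒᵖ ⥤ PartOrd.{u}} (φ : F ⟶ G) (a : C) : Tilde F a →o Tilde G a where
  toFun x := ⟨fun b f => φ.app (op b) (x.1 b f), fun b c g f => by
    have h := ConcreteCategory.congr_hom (φ.naturality g.op) (x.1 b f)
    exact h.symm.le.trans ((φ.app (op c)).hom.monotone (x.2 b c g f))⟩
  monotone' := fun _ _ hxy b f => (φ.app (op b)).hom.monotone (hxy b f)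

variable (C) in
/-- The functor `F ↦ F̃`. -/
def tilde : (Cᵒᵖ ⥤ PartOrd.{u}) ⥤ (Cᵒᵖ ⥤ PartOrd.{u}) where
  obj F :=
    { obj := fun a => PartOrd.of (Tilde F a.unop)
      map := fun h => PartOrd.ofHom (Tilde.res F h.unop)
      map_id := fun a => by
        refine PartOrd.ext fun x => Subtype.ext (funext fun b => funext fun f => ?_)
        exact congrArg (x.1 b) (Category.comp_id f)
      map_comp := fun h k => by
        refine PartOrd.ext fun x => Subtype.ext (funext fun b => funext fun f => ?_)
        exact congrArg (x.1 b) (Category.assoc f k.unop h.unop).symm }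
  map φ :=
    { app := fun a => PartOrd.ofHom (Tilde.map φ a.unop) }

end Tilde

end PresheafFrame

/-!
Let `L` be an internal compact regular frame and `s` the internal join of a directed subset `S` of
`L`. By compactness every cover `s ∨ z = 1` shrinks to a cover `x ∨ z = 1` with `x ∈ S`, so that
`S` contains an element above `y` whenever `y ◁ s`. Applied to the elements well inside an element,
which are directed with that element as join, this shows that every lattice `L(a)` is normal, and
hence that every `C(L(a))` is a compact regular frame. Applied to an internal rounded ideal, that
is, a lax family of rounded ideals of the lattices `L(b)`, it shows that the ideal is determined by
its join: `x ↦ {y | y ◁ x}` is an isomorphism from `L` to the lax families in `C ∘ L`.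

Conversely, for a presheaf `A` of compact regular frames, the strict families `(A(f) x)_f` form a
sublattice of `Ã(a)`, and it is coreflective, since a lax family lies above the strict family of its
value at the identity. The completion `C` inverts coreflections, so `C(Ã(a)) ≅ C(A(a)) ≅ A(a)`.

A compact frame is Hausdorff if and only if it is regular. The proof is constructive, hence can be
carried out in the internal logic of presheaves; the case of presheaves on a point is the statement
over sets.
-/

namespace PresheafFrame

/-! ### The relation `◁` and normal lattices -/

section WellInside

section Lattice

variable {N : Type u} [Lattice N] [BoundedOrder N] {a a' b b' : N}

lemma wellInside_iff : WellInside a b ↔ ∃ c, Disjoint a c ∧ Codisjoint b c := by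
  simp only [WellInside, disjoint_iff, codisjoint_iff]

namespace WellInside

lemma mono (h : WellInside a b) (ha : a' ≤ a) (hb : b ≤ b') : WellInside a' b' :=
  let ⟨c, hac, hbc⟩ := wellInside_iff.1 h
  wellInside_iff.2 ⟨c, hac.mono_left ha, hbc.mono_left hb⟩

lemma bot (b : N) : WellInside ⊥ b :=
  wellInside_iff.2 ⟨⊤, disjoint_bot_left, codisjoint_top_right⟩

lemma top (a : N) : WellInside a ⊤ :=
  wellInside_iff.2 ⟨⊥, disjoint_bot_right, codisjoint_top_left⟩

lemma map {M : Type u} [Lattice M] [BoundedOrder M] (f : BoundedLatticeHom N M)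
    (h : WellInside a b) : WellInside (f a) (f b) :=
  let ⟨c, hac, hbc⟩ := wellInside_iff.1 h
  wellInside_iff.2 ⟨f c, hac.map f, hbc.map f⟩

end WellInside

variable (N) in
/-- A bounded lattice is normal if every cover `x ∨ y = 1` can be shrunk to a cover `x' ∨ y = 1`
with `x' ◁ x`. -/
def IsNormalLattice : Prop :=
  ∀ x y : N, Codisjoint x y → ∃ x', WellInside x' x ∧ Codisjoint x' y

lemma IsNormalLattice.exists_between (hN : IsNormalLattice N) (h : WellInside a b) :
    ∃ b', WellInside a b' ∧ WellInside b' b := by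
  obtain ⟨c, hac, hbc⟩ := wellInside_iff.1 h
  obtain ⟨b', hb, hbc'⟩ := hN b c hbc
  exact ⟨b', wellInside_iff.2 ⟨c, hac, hbc'⟩, hb⟩

end Lattice

namespace WellInside

variable {N : Type u} [DistribLattice N] [BoundedOrder N] {a a' b b' c : N}

lemma le (h : WellInside a b) : a ≤ b :=
  let ⟨_, hac, hbc⟩ := wellInside_iff.1 h
  hac.le_of_codisjoint hbc.symm

lemma sup (h : WellInside a b) (h' : WellInside a' b') : WellInside (a ⊔ a') (b ⊔ b') := by
  obtain ⟨c, hac, hbc⟩ := wellInside_iff.1 h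
  obtain ⟨c', hac', hbc'⟩ := wellInside_iff.1 h'
  exact wellInside_iff.2 ⟨c ⊓ c',
    (hac.mono_right inf_le_left).sup_left (hac'.mono_right inf_le_right),
    (hbc.mono_left le_sup_left).inf_right (hbc'.mono_left le_sup_right)⟩

lemma sup_left (h : WellInside a b) (h' : WellInside a' b) : WellInside (a ⊔ a') b :=
  (h.sup h').mono le_rfl (sup_idem b).le

lemma directedOn (b : N) : DirectedOn (· ≤ ·) {a : N | WellInside a b} :=
  fun a ha a' ha' => ⟨a ⊔ a', sup_left ha ha', le_sup_left, le_sup_right⟩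

lemma inf_right (h : WellInside a b) (h' : WellInside a b') : WellInside a (b ⊓ b') := by
  obtain ⟨c, hac, hbc⟩ := wellInside_iff.1 h
  obtain ⟨c', hac', hbc'⟩ := wellInside_iff.1 h'
  exact wellInside_iff.2 ⟨c ⊔ c', hac.sup_right hac',
    (hbc.mono_right le_sup_left).inf_left (hbc'.mono_right le_sup_right)⟩

lemma inf_of_disjoint (hac : Disjoint a c) (h : WellInside a' (b ⊔ c)) :
    WellInside (a ⊓ a') b := by
  obtain ⟨c', hac', hbc'⟩ := wellInside_iff.1 h
  refine wellInside_iff.2 ⟨c ⊔ c',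
    (hac.mono_left inf_le_left).sup_right (hac'.mono_left inf_le_right), ?_⟩
  rwa [← codisjoint_assoc]

end WellInside

end WellInside

/-! ### The frame of rounded ideals -/

section Ideal

variable {N : Type u} [SemilatticeSup N] [OrderBot N]

/-- The ideal with underlying set `s`, for a lower set `s` closed under finite joins. -/
def idealOfSupClosed (s : Set N) (lower : IsLowerSet s) (bot_mem : ⊥ ∈ s)
    (supClosed : SupClosed s) : Order.Ideal N where
  carrier := s
  lower' := lower
  nonempty' := ⟨⊥, bot_mem⟩
  directed' _ ha _ hb := ⟨_, supClosed ha hb, le_sup_left, le_sup_right⟩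

end Ideal

namespace Completion

variable {N M : Type u} [DistribLattice N] [BoundedOrder N] [DistribLattice M] [BoundedOrder M]

@[ext]
lemma ext {I J : Completion N} (h : ∀ a, a ∈ I.1 ↔ a ∈ J.1) : I = J :=
  Subtype.ext (SetLike.ext h)

/-- The elements well inside some element of an ideal. An ideal `J` is rounded if and only if
`J ≤ interior J`. -/
def interior (J : Order.Ideal N) : Order.Ideal N :=
  idealOfSupClosed {a | ∃ b ∈ J, WellInside a b}
    (fun _ _ h ⟨b, hb, hab⟩ => ⟨b, hb, hab.mono h le_rfl⟩)
    ⟨⊥, J.bot_mem, WellInside.bot _⟩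
    (fun _ ⟨b, hb, hab⟩ _ ⟨b', hb', hab'⟩ => ⟨b ⊔ b', J.sup_mem hb hb', hab.sup hab'⟩)

lemma interior_mono : Monotone (interior : Order.Ideal N → Order.Ideal N) :=
  fun _ _ h _ ⟨b, hb, hab⟩ => ⟨b, h hb, hab⟩

instance : SupSet (Completion N) where
  sSup S := ⟨sSup (Subtype.val '' S), by
    change sSup (Subtype.val '' S) ≤ interior (sSup (Subtype.val '' S))
    refine sSup_le ?_
    rintro _ ⟨I, hI, rfl⟩
    exact le_trans (show I.1 ≤ interior I.1 from I.2)
      (interior_mono (le_sSup (Set.mem_image_of_mem _ hI)))⟩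

/-- To bound a join of rounded ideals, it suffices to bound each of them by an ideal that need not
be rounded. -/
lemma sSup_le_ideal_iff {S : Set (Completion N)} {J : Order.Ideal N} :
    (sSup S).1 ≤ J ↔ ∀ I ∈ S, I.1 ≤ J :=
  sSup_le_iff.trans Set.forall_mem_image

lemma isLUB_sSup (S : Set (Completion N)) : IsLUB S (sSup S) :=
  isLUB_iff_le_iff.2 fun _ => sSup_le_ideal_iff

instance : CompleteLattice (Completion N) where
  __ := completeLatticeOfSup (Completion N) isLUB_sSup
  inf I J := ⟨I.1 ⊓ J.1, fun a ⟨haI, haJ⟩ => by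
    obtain ⟨b, hb, hab⟩ := I.2 a haI
    obtain ⟨b', hb', hab'⟩ := J.2 a haJ
    exact ⟨b ⊓ b', ⟨I.1.lower inf_le_left hb, J.1.lower inf_le_right hb'⟩, hab.inf_right hab'⟩⟩
  inf_le_left _ _ := fun _ ha => ha.1
  inf_le_right _ _ := fun _ ha => ha.2
  le_inf _ _ _ hIJ hIK := fun _ ha => ⟨hIJ ha, hIK ha⟩
  top := ⟨⊤, fun _ _ => ⟨⊤, trivial, WellInside.top _⟩⟩
  le_top _ := fun _ _ => trivial

lemma eq_top_of_top_mem {I : Completion N} (h : ⊤ ∈ I.1) : I = ⊤ :=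
  top_le_iff.1 fun _ _ => I.1.lower le_top h

/-- The elements whose meets with the elements of `I` lie in `J`, i.e. the residual of `J` by `I`
among all ideals. -/
def residual (I J : Order.Ideal N) : Order.Ideal N :=
  idealOfSupClosed {a | ∀ x ∈ I, x ⊓ a ∈ J}
    (fun _ _ h ha x hx => J.lower (inf_le_inf_left x h) (ha x hx))
    (fun x _ => by rw [inf_bot_eq]; exact J.bot_mem)
    (fun a ha b hb x hx => by rw [inf_sup_left]; exact J.sup_mem (ha x hx) (hb x hx))

lemma le_residual_iff {I J K : Completion N} : J.1 ≤ residual I.1 K.1 ↔ I ⊓ J ≤ K := by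
  refine ⟨fun h a ⟨haI, haJ⟩ => ?_, fun h a ha x hx => h ⟨?_, ?_⟩⟩
  · simpa only [inf_idem] using h haJ a haI
  · exact I.1.lower inf_le_left hx
  · exact J.1.lower inf_le_right ha

instance : Order.Frame (Completion N) :=
  Order.Frame.ofMinimalAxioms ⟨fun _ _ => le_residual_iff.1 <| sSup_le_ideal_iff.2 fun J hJ =>
    le_residual_iff.2 (le_iSup₂_of_le J hJ le_rfl)⟩

lemma isCompactElement_top : IsCompactElement (⊤ : Completion N) := by
  rw [CompleteLattice.isCompactElement_iff_le_of_directed_sSup_le]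
  intro S hne hdir hS
  obtain ⟨I₀, hI₀⟩ := hne
  let union : Order.Ideal N := idealOfSupClosed {a | ∃ I ∈ S, a ∈ I.1}
    (fun _ _ h ⟨I, hI, ha⟩ => ⟨I, hI, I.1.lower h ha⟩)
    ⟨I₀, hI₀, I₀.1.bot_mem⟩
    (fun _ ⟨I, hI, ha⟩ _ ⟨J, hJ, hb⟩ =>
      let ⟨K, hK, hIK, hJK⟩ := hdir I hI J hJ
      ⟨K, hK, K.1.sup_mem (hIK ha) (hJK hb)⟩)
  have hle : (sSup S).1 ≤ union := sSup_le_ideal_iff.2 fun I hI a ha => ⟨I, hI, ha⟩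
  obtain ⟨I, hI, htop⟩ := hle (hS (show ⊤ ∈ (⊤ : Completion N).1 from trivial))
  exact ⟨I, hI, (eq_top_of_top_mem htop).ge⟩

/-- The rounded ideal of the elements well inside `x`. -/
def below (hN : IsNormalLattice N) (x : N) : Completion N :=
  ⟨idealOfSupClosed {a | WellInside a x} (fun _ _ h ha => ha.mono h le_rfl) (WellInside.bot x)
    fun _ ha _ hb => ha.sup_left hb,
   fun _ ha => let ⟨b, hab, hb⟩ := hN.exists_between ha; ⟨b, hb, hab⟩⟩

/-- `hs` is what compactness gives when `s` is the join of `I`, over sets or internally. -/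
lemma below_eq {hN : IsNormalLattice N} {I : Completion N} {s : N} (hI : ∀ x ∈ I.1, x ≤ s)
    (hs : ∀ z, Codisjoint s z → ∃ x ∈ I.1, Codisjoint x z) : below hN s = I := by
  ext y
  refine ⟨fun hy => ?_, fun hy => ?_⟩
  · obtain ⟨z, hyz, hsz⟩ := wellInside_iff.1 hy
    obtain ⟨x, hx, hxz⟩ := hs z hsz
    exact I.1.lower (hyz.le_of_codisjoint hxz.symm) hx
  · obtain ⟨x, hx, hyx⟩ := I.2 y hy
    exact hyx.mono le_rfl (hI x hx)

lemma wellInside_below {hN : IsNormalLattice N} {I : Completion N} {x b : N}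
    (hxb : WellInside x b) (hb : b ∈ I.1) : WellInside (below hN x) I := by
  obtain ⟨c, hxc, hbc⟩ := wellInside_iff.1 hxb
  obtain ⟨c', hc', hbc'⟩ := hN c b hbc.symm
  refine ⟨below hN c, le_bot_iff.1 fun a ha => ?_, eq_top_of_top_mem ?_⟩
  · rw [le_bot_iff.1 (hxc (WellInside.le ha.1) (WellInside.le ha.2))]
    exact Order.Ideal.bot_mem _
  · rw [← codisjoint_iff.1 hbc']
    exact Order.Ideal.sup_mem ((le_sup_right : below hN c ≤ I ⊔ below hN c) hc')
      ((le_sup_left : I ≤ I ⊔ below hN c) hb)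

lemma isRegularFrame (hN : IsNormalLattice N) : IsRegularFrame (Completion N) := by
  refine fun I => le_antisymm (fun a ha => ?_) (sSup_le fun J hJ => hJ.le)
  obtain ⟨b, hb, hab⟩ := I.2 a ha
  obtain ⟨b', hab', hb'b⟩ := hN.exists_between hab
  exact (le_sSup (wellInside_below hb'b hb) : below hN b' ≤ _) hab'

/-- The preimage of an ideal under a lattice homomorphism. -/
def comapIdeal (f : BoundedLatticeHom N M) (J : Order.Ideal M) : Order.Ideal N :=
  idealOfSupClosed {a | f a ∈ J} (fun _ _ h ha => J.lower (OrderHomClass.mono f h) ha)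
    (by rw [Set.mem_ofPred_eq, map_bot]; exact J.bot_mem)
    (fun a ha b hb => by rw [Set.mem_ofPred_eq, map_sup]; exact J.sup_mem ha hb)

lemma le_comapIdeal_iff {f : BoundedLatticeHom N M} {I : Completion N} {J : Completion M} :
    I.1 ≤ comapIdeal f J.1 ↔ Completion.map f I ≤ J :=
  ⟨fun h _ ⟨_, hx, hy⟩ => J.1.lower hy (h hx), fun h x hx => h ⟨x, hx, le_rfl⟩⟩

/-- The frame homomorphism `C(f) : C(N) → C(M)`. -/
def frameHom (f : BoundedLatticeHom N M) : FrameHom (Completion N) (Completion M) where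
  toFun := Completion.map f
  map_top' := eq_top_of_top_mem ⟨⊤, trivial, (map_top f).ge⟩
  map_inf' I J := by
    refine le_antisymm (le_inf ((Completion.map f).monotone inf_le_left)
      ((Completion.map f).monotone inf_le_right)) ?_
    rintro y ⟨⟨x, hx, hy⟩, x', hx', hy'⟩
    exact ⟨x ⊓ x', ⟨I.1.lower inf_le_left hx, J.1.lower inf_le_right hx'⟩,
      (le_inf hy hy').trans (map_inf f x x').ge⟩
  map_sSup' S := eq_of_forall_ge_iff fun J => by
    rw [← le_comapIdeal_iff, sSup_le_ideal_iff, sSup_le_iff, Set.forall_mem_image]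
    simp only [le_comapIdeal_iff]

lemma map_comp {K : Type u} [DistribLattice K] [BoundedOrder K] (g : BoundedLatticeHom M K)
    (f : BoundedLatticeHom N M) (I : Completion N) : map (g.comp f) I = map g (map f I) :=
  ConcreteCategory.congr_hom (completion.map_comp (BddDistLat.ofHom f) (BddDistLat.ofHom g)) I

lemma map_below {hN : IsNormalLattice N} {hM : IsNormalLattice M} {f : BoundedLatticeHom N M}
    {x : N} (h : ∀ z, Codisjoint (f x) z → ∃ y, WellInside y x ∧ Codisjoint (f y) z) :
    map f (below hN x) = below hM (f x) :=
  (below_eq (I := map f (below hN x))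
    (fun _ ⟨_, hy, hz⟩ => hz.trans (OrderHomClass.mono f (WellInside.le hy)))
    fun z hz => let ⟨y, hy, hyz⟩ := h z hz; ⟨f y, ⟨y, hy, le_rfl⟩, hyz⟩).symm

/-- The completion inverts coreflections: the image of `i` contains an element between `y` and `b`
whenever `y ◁ b`, namely `i (p b)`. -/
def orderIsoOfCoreflection (i : BoundedLatticeHom M N) (p : BoundedLatticeHom N M)
    (hpi : ∀ x, p (i x) = x) (hip : ∀ y, i (p y) ≤ y) : Completion M ≃o Completion N :=
  Equiv.toOrderIso
    { toFun := map i
      invFun := map p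
      left_inv I := by
        ext y
        refine ⟨fun ⟨z, ⟨x, hx, hz⟩, hy⟩ => I.1.lower ?_ hx, fun hy => ?_⟩
        · exact hy.trans ((OrderHomClass.mono p hz).trans (hpi x).le)
        · exact ⟨i y, ⟨y, hy, le_rfl⟩, (hpi y).ge⟩
      right_inv I := by
        ext y
        refine ⟨fun ⟨z, ⟨x, hx, hz⟩, hy⟩ => I.1.lower ?_ hx, fun hy => ?_⟩
        · exact hy.trans ((OrderHomClass.mono i hz).trans (hip x))
        · obtain ⟨b, hb, hyb⟩ := I.2 y hy
          obtain ⟨c, hyc, hbc⟩ := wellInside_iff.1 hyb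
          refine ⟨p b, ⟨b, hb, le_rfl⟩, (hyc.mono_right (hip c)).le_of_codisjoint ?_⟩
          exact ((hbc.map p).map i).symm }
    (map i).monotone (map p).monotone

end Completion

/-! ### Compact regular frames -/

section CompactRegular

variable {L M : Type u} [Order.Frame L] [Order.Frame M]

lemma exists_mem_codisjoint_of_sSup (hL : IsCompactElement (⊤ : L)) {S : Set L}
    (hne : S.Nonempty) (hdir : DirectedOn (· ≤ ·) S) {z : L} (h : Codisjoint (sSup S) z) :
    ∃ x ∈ S, Codisjoint x z := by
  obtain ⟨x₀, hx₀⟩ := hne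
  have hle {x : L} (hx : x ∈ S) : x ⊔ z ≤ sSup ((· ⊔ z) '' S) := le_sSup ⟨x, hx, rfl⟩
  have htop : ⊤ ≤ sSup ((· ⊔ z) '' S) := h.eq_top.ge.trans
    (sup_le (sSup_le fun x hx => le_sup_left.trans (hle hx)) (le_sup_right.trans (hle hx₀)))
  obtain ⟨_, ⟨x, hx, rfl⟩, hxz⟩ :=
    (CompleteLattice.isCompactElement_iff_le_of_directed_sSup_le _ _).1 hL _
      (Set.Nonempty.image _ ⟨x₀, hx₀⟩) (hdir.mono_comp fun _ _ hxy => sup_le_sup_right hxy z) htop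
  exact ⟨x, hx, codisjoint_iff_le_sup.2 hxz⟩

lemma IsRegularFrame.isNormalLattice (hr : IsRegularFrame L) (hL : IsCompactElement (⊤ : L)) :
    IsNormalLattice L := fun x _ hxy =>
  exists_mem_codisjoint_of_sSup (S := {a | WellInside a x}) hL ⟨⊥, WellInside.bot x⟩
    (WellInside.directedOn x) (hr x ▸ hxy)

namespace Completion

lemma below_sSup {hN : IsNormalLattice L} (hL : IsCompactElement (⊤ : L)) (I : Completion L) :
    below hN (sSup (I.1 : Set L)) = I :=
  below_eq (fun _ hx => le_sSup hx)
    fun _ hz => exists_mem_codisjoint_of_sSup hL I.1.nonempty I.1.directed hz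

/-- A compact regular frame is isomorphic to its completion. -/
def belowIso (hL : IsCompactElement (⊤ : L)) (hr : IsRegularFrame L) : L ≃o Completion L :=
  Equiv.toOrderIso
    { toFun := below (hr.isNormalLattice hL)
      invFun I := sSup (I.1 : Set L)
      left_inv x := (hr x).symm
      right_inv := below_sSup hL }
    (fun _ _ h _ ha => WellInside.mono ha le_rfl h) (fun _ _ h => sSup_le_sSup h)

lemma frameHom_map_below (hr : IsRegularFrame L) (hM : IsCompactElement (⊤ : M))
    {hN : IsNormalLattice L} {hN' : IsNormalLattice M} (f : FrameHom L M) (x : L) :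
    map (f : BoundedLatticeHom L M) (below hN x) = below hN' (f x) := by
  refine map_below fun z hz => ?_
  have hz' : Codisjoint (sSup (f '' {a | WellInside a x})) z := by
    rwa [← map_sSup, ← hr x]
  obtain ⟨_, ⟨y, hy, rfl⟩, hyz⟩ := exists_mem_codisjoint_of_sSup hM
    (Set.Nonempty.image f ⟨⊥, WellInside.bot x⟩)
    ((WellInside.directedOn x).mono_comp (OrderHomClass.mono f)) hz'
  exact ⟨y, hy, hyz⟩

end Completion

end CompactRegular

/-- The completion `C(N)` as a functor to frames. -/
def completionFrm : BddDistLat.{u} ⥤ Frm.{u} where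
  obj N := Frm.of (Completion N)
  map f := Frm.ofHom (Completion.frameHom f.hom)
  map_id N := Frm.ext fun I => ConcreteCategory.congr_hom (completion.map_id N) I
  map_comp f g := Frm.ext fun I => ConcreteCategory.congr_hom (completion.map_comp f g) I

/-! ### Joins in the internal logic -/

section Internal

variable {C : Type u} [SmallCategory C] {L M : Cᵒᵖ ⥤ BddDistLat.{u}} {c : C}

namespace SubsetAt

/-- The restriction of a subset to a later stage. -/
def restrict (S : SubsetAt L c) {b : C} (f : b ⟶ c) : SubsetAt L b where
  mem g := S.mem (g ≫ f)
  mem_res g h x hx := by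
    rw [Category.assoc]
    exact S.mem_res _ h hx

lemma mem_restrict_id {S : SubsetAt L c} {b : C} {f : b ⟶ c} {x : L.obj (op b)} :
    x ∈ (S.restrict f).mem (𝟙 b) ↔ x ∈ S.mem f := by
  simp only [restrict, Category.id_comp]

lemma wellInside_restrict (x : L.obj (op c)) {b : C} (f : b ⟶ c) :
    (wellInside x).restrict f = wellInside (res L f x) := by
  ext d g a
  simp only [wellInside, restrict, res_comp, Set.mem_ofPred_eq]

lemma mem_wellInside_id {x y : L.obj (op c)} : y ∈ (wellInside x).mem (𝟙 c) ↔ WellInside y x := by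
  simp only [wellInside, res_id, Set.mem_ofPred_eq]

namespace IsJoin

variable {S : SubsetAt L c} {s s' x y : L.obj (op c)}

lemma restrict (h : S.IsJoin s) {b : C} (f : b ⟶ c) : (S.restrict f).IsJoin (res L f s) := by
  refine ⟨fun g y hy => ?_, fun g x hx => ?_⟩
  · rw [← res_comp]
    exact h.1 (g ≫ f) y hy
  · rw [← res_comp]
    refine h.2 (g ≫ f) x fun k y hy => hx k y ?_
    simpa only [SubsetAt.restrict, Category.assoc] using hy

lemma le (h : S.IsJoin s)
    (hx : ∀ {b : C} (f : b ⟶ c) (y : L.obj (op b)), y ∈ S.mem f → y ≤ res L f x) : s ≤ x := by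
  rw [← res_id L s]
  refine h.2 (𝟙 c) x fun g y hy => hx g y ?_
  rwa [Category.comp_id] at hy

lemma mem_le (h : S.IsJoin s) (hy : y ∈ S.mem (𝟙 c)) : y ≤ s := by
  rw [← res_id L s]
  exact h.1 (𝟙 c) y hy

lemma unique (h : S.IsJoin s) (h' : S.IsJoin s') : s = s' :=
  le_antisymm (h.le h'.1) (h'.le h.1)

end IsJoin

/-- The subset `{x, y}`. -/
def pair (x y : L.obj (op c)) : SubsetAt L c where
  mem f := {res L f x, res L f y}
  mem_res f g := by
    rintro _ (rfl | rfl)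
    · exact Or.inl (res_comp L g f x).symm
    · exact Or.inr (res_comp L g f y).symm

lemma isJoin_pair (x y : L.obj (op c)) : (pair x y).IsJoin (x ⊔ y) := by
  refine ⟨?_, fun f w hw => ?_⟩
  · rintro b f _ (rfl | rfl)
    · exact OrderHomClass.mono _ le_sup_left
    · exact OrderHomClass.mono _ le_sup_right
  · rw [map_sup]
    refine sup_le ?_ ?_
    · simpa only [res_id] using hw (𝟙 _) (res L f x) (Or.inl (by rw [Category.id_comp]))
    · simpa only [res_id] using hw (𝟙 _) (res L f y) (Or.inr (by rw [Category.id_comp]; rfl))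

/-- The subset `{y ∨ z | y ∈ S}`. -/
def joinWith (S : SubsetAt L c) (z : L.obj (op c)) : SubsetAt L c where
  mem f := (· ⊔ res L f z) '' S.mem f
  mem_res f g := by
    rintro _ ⟨y, hy, rfl⟩
    exact ⟨res L g y, S.mem_res f g hy, by rw [map_sup, res_comp]⟩

lemma IsJoin.joinWith {S : SubsetAt L c} {s : L.obj (op c)} (h : S.IsJoin s)
    (hS : ∀ {b : C} (f : b ⟶ c), (S.mem f).Nonempty) (z : L.obj (op c)) :
    (S.joinWith z).IsJoin (s ⊔ z) := by
  refine ⟨?_, fun {b} f x hx => ?_⟩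
  · rintro b f _ ⟨y, hy, rfl⟩
    rw [map_sup]
    exact sup_le_sup_right (h.1 f y hy) _
  · obtain ⟨y, hy⟩ := hS (𝟙 b ≫ f)
    have hyz := hx (𝟙 b) _ ⟨y, hy, rfl⟩
    rw [res_id, Category.id_comp] at hyz
    rw [map_sup]
    exact sup_le (h.2 f x fun g y hy => le_sup_left.trans (hx g _ ⟨y, hy, rfl⟩))
      (le_sup_right.trans hyz)

namespace IsDirected

variable {S : SubsetAt L c}

lemma restrict (h : S.IsDirected) {b : C} (f : b ⟶ c) : (S.restrict f).IsDirected :=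
  fun g => h (g ≫ f)

lemma joinWith (h : S.IsDirected) (z : L.obj (op c)) : (S.joinWith z).IsDirected := fun f =>
  ⟨(h f).1.image _, (h f).2.mono_comp (fun _ _ hxy => sup_le_sup_right hxy _)⟩

lemma image (h : S.IsDirected) (φ : L ⟶ M) : (S.image φ).IsDirected := fun {b} f =>
  ⟨(h f).1.image _, (h f).2.mono_comp (OrderHomClass.mono (φ.app (op b)).hom)⟩

end IsDirected

lemma isDirected_wellInside (b : L.obj (op c)) : (wellInside b).IsDirected := fun _ =>
  ⟨⟨⊥, WellInside.bot _⟩, WellInside.directedOn _⟩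

end SubsetAt

/-! ### Internal compactness and regularity -/

namespace IsInternallyCompact

variable {S : SubsetAt L c} {s z : L.obj (op c)}

lemma exists_mem_codisjoint (hc : IsInternallyCompact L) (hS : S.IsDirected) (hs : S.IsJoin s)
    (h : Codisjoint s z) : ∃ x ∈ S.mem (𝟙 c), Codisjoint x z := by
  have hjoin := hs.joinWith (fun f => (hS f).1) z
  rw [codisjoint_iff.1 h] at hjoin
  obtain ⟨x, hx, hxz⟩ := hc _ (hS.joinWith z) hjoin
  exact ⟨x, hx, codisjoint_iff.2 (by simpa only [res_id] using hxz)⟩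

lemma isNormalLattice (hc : IsInternallyCompact L) (hr : IsInternallyRegular L) (c : C) :
    IsNormalLattice (L.obj (op c)) := fun x _ hxy =>
  let ⟨x', hx', h⟩ := hc.exists_mem_codisjoint (SubsetAt.isDirected_wellInside x) (hr x) hxy
  ⟨x', SubsetAt.mem_wellInside_id.1 hx', h⟩

end IsInternallyCompact

namespace IsInternalFrame

variable (hF : IsInternalFrame L)

include hF in
lemma inf_join_le {S : SubsetAt L c} {a s x : L.obj (op c)} (hs : S.IsJoin s)
    (hx : ∀ {b : C} (f : b ⟶ c) (y : L.obj (op b)), y ∈ S.mem f → res L f a ⊓ y ≤ res L f x) :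
    a ⊓ s ≤ x := by
  refine (hF.meet_join a S s hs).le ?_
  rintro b f _ ⟨y, hy, rfl⟩
  exact hx f y hy

/-- The join of the elements well inside `b`. Regularity says that `core b = b`. -/
noncomputable def core (b : L.obj (op c)) : L.obj (op c) :=
  (hF.exists_join (SubsetAt.wellInside b)).choose

lemma isJoin_core (b : L.obj (op c)) : (SubsetAt.wellInside b).IsJoin (hF.core b) :=
  (hF.exists_join (SubsetAt.wellInside b)).choose_spec

lemma res_core {b : C} (f : b ⟶ c) (x : L.obj (op c)) :
    res L f (hF.core x) = hF.core (res L f x) := by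
  have h := (hF.isJoin_core x).restrict f
  rw [SubsetAt.wellInside_restrict] at h
  exact h.unique (hF.isJoin_core _)

lemma le_core_of_wellInside {a b : L.obj (op c)} (h : WellInside a b) : a ≤ hF.core b :=
  (hF.isJoin_core b).mem_le (SubsetAt.mem_wellInside_id.2 h)

lemma core_le (b : L.obj (op c)) : hF.core b ≤ b :=
  (hF.isJoin_core b).le fun _ _ h => h.le

lemma core_top : hF.core (⊤ : L.obj (op c)) = ⊤ :=
  top_le_iff.1 (hF.le_core_of_wellInside (WellInside.top ⊤))

lemma isInternallyRegular_of_le_core (h : ∀ {c : C} (b : L.obj (op c)), b ≤ hF.core b) :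
    IsInternallyRegular L := fun b => by
  have hb := hF.isJoin_core b
  rwa [(hF.core_le b).antisymm (h b)] at hb

lemma inf_core_sup_le {v z : L.obj (op c)} (hvz : Disjoint v z) (a : L.obj (op c)) :
    v ⊓ hF.core (a ⊔ z) ≤ hF.core a := by
  refine hF.inf_join_le (hF.isJoin_core _) fun f y hy => ?_
  rw [res_core]
  refine hF.le_core_of_wellInside (WellInside.inf_of_disjoint (hvz.map (res L f)) ?_)
  rw [← map_sup]
  exact hy

end IsInternalFrame

/-! ### Internal compact Hausdorff locales are the internal compact regular ones -/

namespace RelAt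

variable {W : RelAt L c}

/-- The relation `{(y, x) | (x, y) ∈ W}`. -/
def swap (W : RelAt L c) : RelAt L c where
  mem f := Prod.swap ⁻¹' W.mem f
  mem_res f g _ _ h := W.mem_res f g h

namespace IsProductOpen

lemma swap (hW : W.IsProductOpen) : W.swap.IsProductOpen where
  lower f _ _ hpq hp := hW.lower f (Prod.swap_le_swap.2 hpq) hp
  join_left := hW.join_right
  join_right := hW.join_left

lemma mono (hW : W.IsProductOpen) {b : C} {f : b ⟶ c} {x x' y y' : L.obj (op b)}
    (h : (x, y) ∈ W.mem f) (hx : x' ≤ x) (hy : y' ≤ y) : (x', y') ∈ W.mem f :=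
  hW.lower f (Prod.mk_le_mk.2 ⟨hx, hy⟩) h

lemma sup_left (hW : W.IsProductOpen) {b : C} {f : b ⟶ c} {x x' y : L.obj (op b)}
    (h : (x, y) ∈ W.mem f) (h' : (x', y) ∈ W.mem f) : (x ⊔ x', y) ∈ W.mem f := by
  refine hW.join_left f _ _ _ (SubsetAt.isJoin_pair x x') ?_
  rintro d g _ (rfl | rfl)
  · exact W.mem_res f g h
  · exact W.mem_res f g h'

variable (hr : IsInternallyRegular L) (hW : W.IsProductOpen)
  (h₀ : ∀ {b : C} (f : b ⟶ c) (x y : L.obj (op b)), x ⊓ y = ⊥ → (x, y) ∈ W.mem f)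

include hr hW h₀

lemma mem_of_inf_left_mem {b : C} {f : b ⟶ c} {x y : L.obj (op b)}
    (h : (x ⊓ y, y) ∈ W.mem f) : (x, y) ∈ W.mem f := by
  -- By regularity `y` may be replaced by `v ◁ y`; if `v ∧ z = 0` and `y ∨ z = 1`, then
  -- `x = (x ∧ y) ∨ (x ∧ z)` and `x ∧ z` is disjoint from `v`.
  refine hW.join_right f _ _ _ (hr y) fun {d} g v hv => ?_
  have hvy : v ≤ res L g y := WellInside.le hv
  obtain ⟨z, hvz, hyz⟩ := hv
  have hx : (res L g x ⊓ res L g y) ⊔ (res L g x ⊓ z) = res L g x := by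
    rw [← inf_sup_left, hyz, inf_top_eq]
  rw [← hx, ← map_inf]
  refine hW.sup_left (hW.mono (W.mem_res f g h) le_rfl hvy) (h₀ _ _ _ ?_)
  rw [inf_assoc, inf_comm z v, hvz, inf_bot_eq]

lemma mem_of_inf_mem {b : C} {f : b ⟶ c} {x y : L.obj (op b)}
    (h : (x ⊓ y, x ⊓ y) ∈ W.mem f) : (x, y) ∈ W.mem f := by
  refine hW.mem_of_inf_left_mem hr h₀ ?_
  refine hW.swap.mem_of_inf_left_mem (x := y) (y := x ⊓ y) hr
    (fun f x y hxy => h₀ f y x (inf_comm x y ▸ hxy)) ?_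
  rwa [inf_eq_right.2 inf_le_right]

end IsProductOpen

end RelAt

lemma IsInternallyRegular.isInternallyHausdorff (hr : IsInternallyRegular L)
    (hF : IsInternalFrame L) : IsInternallyHausdorff L := by
  intro c W hW h₀
  let diagonal : SubsetAt L c :=
    ⟨fun f => {x | (x, x) ∈ W.mem f}, fun f g _ hx => W.mem_res f g hx⟩
  obtain ⟨a, ha⟩ := hF.exists_join diagonal
  have hdiag : (a, a) ∈ W.mem (𝟙 c) := by
    refine hW.join_left (𝟙 c) diagonal a a ha fun g x _ => ?_
    refine hW.join_right _ (diagonal.restrict g) _ x (ha.restrict g) fun k y hy => ?_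
    refine hW.mem_of_inf_mem hr h₀ (hW.mono (x := y) (y := y) ?_ inf_le_right inf_le_right)
    rw [Category.comp_id]
    exact hy
  refine ⟨a, fun f x y => ⟨fun h => ?_, fun h => ?_⟩⟩
  · exact ha.1 f _ (hW.mono h inf_le_left inf_le_right)
  · have hres := W.mem_res (𝟙 c) f hdiag
    rw [Category.comp_id] at hres
    exact hW.mem_of_inf_mem hr h₀ (hW.mono hres h h)

section CoverRel

variable (hF : IsInternalFrame L) (b : L.obj (op c))

/-- The pairs `(x, y)` such that `y ≤ core u` for every `u ≥ b` with `u ∨ x = 1`. Applying the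
Hausdorff property to this relation proves that `b ≤ core b`. -/
def coverRel : RelAt L c where
  mem {d} f := {p | ∀ {e : C} (g : e ⟶ d) (u : L.obj (op e)), res L (g ≫ f) b ≤ u →
    Codisjoint u (res L g p.1) → res L g p.2 ≤ hF.core u}
  mem_res f g x y h e k u hbu hu := by
    rw [← res_comp] at hu ⊢
    rw [← Category.assoc] at hbu
    exact h (k ≫ g) u hbu hu

variable {b} {d : C} {f : d ⟶ c}

lemma sup_mem_coverRel {x x' y : L.obj (op d)} (h : (x, y) ∈ (coverRel hF b).mem f)
    (h' : (x', y) ∈ (coverRel hF b).mem f) : (x ⊔ x', y) ∈ (coverRel hF b).mem f := by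
  intro e g u hbu hu
  rw [map_sup, ← codisjoint_assoc] at hu
  have hy : res L g y ≤ hF.core (u ⊔ res L g x) := h' g _ (hbu.trans le_sup_left) hu
  refine (le_inf le_rfl hy).trans (hF.inf_join_le (hF.isJoin_core _) fun {e'} k v hv => ?_)
  obtain ⟨z, hvz, huxz⟩ := wellInside_iff.1 hv
  have hyz : res L (k ≫ g) y ≤ hF.core (res L k u ⊔ z) := by
    refine h (k ≫ g) _ ?_ ?_
    · rw [Category.assoc, res_comp]
      exact le_sup_of_le_left (OrderHomClass.mono (res L k) hbu)
    · rw [map_sup, ← res_comp] at huxz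
      exact codisjoint_right_comm.1 huxz
  rw [← res_comp, inf_comm, hF.res_core]
  exact (inf_le_inf_left v hyz).trans (hF.inf_core_sup_le hvz _)

variable (b f) in
/-- The elements `x` with `(x, y)` in `coverRel b`. -/
def coverSlice (y : L.obj (op d)) : SubsetAt L d where
  mem g := {x | (x, res L g y) ∈ (coverRel hF b).mem (g ≫ f)}
  mem_res g k x hx := by
    rw [Set.mem_ofPred_eq, Category.assoc, res_comp]
    exact (coverRel hF b).mem_res _ k hx

lemma isDirected_coverSlice (y : L.obj (op d)) : (coverSlice hF b f y).IsDirected := fun _ => by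
  refine ⟨⟨⊥, fun g u _ hu => ?_⟩, fun x hx x' hx' =>
    ⟨x ⊔ x', sup_mem_coverRel hF hx hx', le_sup_left, le_sup_right⟩⟩
  rw [map_bot, codisjoint_bot] at hu
  rw [hu, hF.core_top]
  exact le_top

variable (b) in
lemma isProductOpen_coverRel (hc : IsInternallyCompact L) : (coverRel hF b).IsProductOpen where
  lower f p q hpq hp e g u hbu hu :=
    (OrderHomClass.mono (res L g) hpq.2).trans
      (hp g u hbu (hu.mono_right (OrderHomClass.mono (res L g) hpq.1)))
  join_right f S t x ht h e g u hbu hu := by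
    refine (ht.restrict g).le fun {e'} k y hy => ?_
    rw [hF.res_core]
    simpa only [res_id] using h (k ≫ g) y hy (𝟙 e') (res L k u)
      (by
        rw [Category.id_comp, Category.assoc, res_comp]
        exact OrderHomClass.mono (res L k) hbu)
      (by
        rw [res_id, res_comp]
        exact hu.map (res L k))
  join_left f S t y ht h e g u hbu hu := by
    let slice := (coverSlice hF b f y).restrict g
    have hslice : slice.IsDirected := fun k => isDirected_coverSlice hF y (k ≫ g)
    obtain ⟨r, hr⟩ := hF.exists_join slice
    have htr : res L g t ≤ r := (ht.restrict g).le fun k x hx => hr.1 k x (h (k ≫ g) x hx)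
    obtain ⟨x, hx, hxu⟩ := hc.exists_mem_codisjoint hslice hr (hu.symm.mono_left htr)
    have hx' : (x, res L (𝟙 e ≫ g) y) ∈ (coverRel hF b).mem ((𝟙 e ≫ g) ≫ f) := hx
    rw [Category.id_comp] at hx'
    simpa only [res_id] using hx' (𝟙 e) u (by rwa [Category.id_comp])
      (by rw [res_id]; exact hxu.symm)

end CoverRel

lemma IsInternallyHausdorff.isInternallyRegular (h : IsInternallyHausdorff L)
    (hF : IsInternalFrame L) (hc : IsInternallyCompact L) : IsInternallyRegular L := by
  refine hF.isInternallyRegular_of_le_core fun {c} b => ?_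
  obtain ⟨a, ha⟩ := h _ (isProductOpen_coverRel hF b hc) (fun f x y hxy e g u _ hu =>
    hF.le_core_of_wellInside (wellInside_iff.2
      ⟨res L g x, (disjoint_iff.2 hxy).symm.map (res L g), hu⟩))
  have hb : (b, ⊤) ∈ (coverRel hF b).mem (𝟙 c) := fun g u hbu hu => by
    rw [Category.comp_id] at hbu
    rw [codisjoint_self.1 (hu.mono_right hbu), hF.core_top]
    exact le_top
  have hb' : (⊤, b) ∈ (coverRel hF b).mem (𝟙 c) := by
    rw [ha, inf_comm, ← ha]
    exact hb
  simpa only [res_id] using hb' (𝟙 c) b (by rw [Category.comp_id, res_id])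
    (by rw [map_top]; exact codisjoint_top_right)

lemma isInternallyHausdorff_iff_isInternallyRegular (hF : IsInternalFrame L)
    (hc : IsInternallyCompact L) : IsInternallyHausdorff L ↔ IsInternallyRegular L :=
  ⟨fun h => h.isInternallyRegular hF hc, fun h => h.isInternallyHausdorff hF⟩

end Internal

/-! ### Locales over sets as locales over a point -/

section Point

variable {L : Type u} [Order.Frame L] {c : Discrete PUnit.{u + 1}}

variable (L) in
/-- A frame as a presheaf of lattices on the one-object discrete category. The internal logic of
presheaves on this category is the logic of sets, so that facts about internal frames specialise to
facts about frames. -/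
abbrev pointPresheaf : (Discrete PUnit.{u + 1})ᵒᵖ ⥤ BddDistLat.{u} :=
  (Functor.const _).obj (BddDistLat.of L)

/-- A subset of a frame `L`, as a subset of `pointPresheaf L`. -/
def pointSubset (c : Discrete PUnit.{u + 1}) (S : Set L) : SubsetAt (pointPresheaf L) c where
  mem _ := S
  mem_res _ _ _ hx := hx

/-- A relation on a frame `L`, as a relation on `pointPresheaf L`. -/
def pointRel (c : Discrete PUnit.{u + 1}) (W : Set (L × L)) : RelAt (pointPresheaf L) c where
  mem _ := W
  mem_res _ _ _ _ hxy := hxy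

lemma pointSubset_surjective : Function.Surjective (pointSubset (L := L) c) := fun S => by
  refine ⟨S.mem (𝟙 c), SubsetAt.ext ?_⟩
  funext b f
  obtain rfl : b = c := Subsingleton.elim b c
  exact congrArg S.mem (Subsingleton.elim (𝟙 b) f)

lemma pointRel_surjective : Function.Surjective (pointRel (L := L) c) := fun ⟨mem, _⟩ => by
  refine ⟨mem (𝟙 c), (RelAt.mk.injEq _ _ _ _).mpr ?_⟩
  funext b f
  obtain rfl : b = c := Subsingleton.elim b c
  exact congrArg mem (Subsingleton.elim (𝟙 b) f)

lemma isJoin_pointSubset_iff {S : Set L} {s : L} : (pointSubset c S).IsJoin s ↔ IsLUB S s :=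
  ⟨fun h => ⟨fun _ hy => h.mem_le hy, fun _ hx => h.le fun _ _ hy => hx hy⟩,
    fun h => ⟨fun _ _ hy => h.1 hy, fun _ _ hx => h.2 fun y hy => hx (𝟙 _) y hy⟩⟩

lemma isInternalFrame_pointPresheaf : IsInternalFrame (pointPresheaf L) where
  exists_join S := by
    obtain ⟨S, rfl⟩ := pointSubset_surjective S
    exact ⟨_, isJoin_pointSubset_iff.2 (isLUB_sSup S)⟩
  meet_join {c} a S s hs := by
    obtain ⟨S, rfl⟩ := pointSubset_surjective S
    have hmeet : (pointSubset c S).meetWith a = pointSubset (L := L) c ((a ⊓ ·) '' S) := by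
      ext b f z
      exact exists_congr fun y => and_congr_right fun _ => eq_comm
    rw [hmeet]
    exact isJoin_pointSubset_iff.2
      ((gc_inf_himp (α := L) (a := a)).isLUB_l_image (isJoin_pointSubset_iff.1 hs))

lemma isInternallyCompact_pointPresheaf (hL : IsCompactElement (⊤ : L)) :
    IsInternallyCompact (pointPresheaf L) := by
  intro c S hS htop
  obtain ⟨S, rfl⟩ := pointSubset_surjective S
  obtain ⟨x, hx, hle⟩ := (CompleteLattice.isCompactElement_iff_le_of_directed_sSup_le _ _).1 hL S
    (hS (𝟙 c)).1 (hS (𝟙 c)).2 (isJoin_pointSubset_iff.1 htop).sSup_eq.ge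
  rwa [← top_le_iff.1 hle]

lemma isInternallyRegular_pointPresheaf_iff :
    IsInternallyRegular (pointPresheaf L) ↔ IsRegularFrame L := by
  have h (c : Discrete PUnit) (b : L) :
      (SubsetAt.wellInside (L := pointPresheaf L) (c := c) b).IsJoin b ↔
        b = sSup {a | WellInside a b} :=
    (isJoin_pointSubset_iff (S := {a | WellInside a b})).trans (isLUB_iff_sSup_eq.trans eq_comm)
  exact ⟨fun hr b => (h ⟨⟨⟩⟩ b).1 (hr b), fun hr c b => (h c b).2 (hr b)⟩

lemma isProductOpen_pointRel_iff {W : Set (L × L)} :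
    (pointRel c W).IsProductOpen ↔ IsProductOpen W := by
  refine ⟨fun h => ⟨h.lower (𝟙 c), fun S y hS => ?_, fun x S hS => ?_⟩,
    fun h => ⟨fun _ => h.lower, fun {b} f S s y hs hS => ?_, fun {b} f S s x hs hS => ?_⟩⟩
  · exact h.join_left (𝟙 c) (pointSubset c S) _ y (isJoin_pointSubset_iff.2 (isLUB_sSup S))
      fun _ x hx => hS x hx
  · exact h.join_right (𝟙 c) (pointSubset c S) _ x (isJoin_pointSubset_iff.2 (isLUB_sSup S))
      fun _ y hy => hS y hy
  · obtain ⟨S, rfl⟩ := pointSubset_surjective S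
    rw [← (isJoin_pointSubset_iff.1 hs).sSup_eq]
    exact h.sSup_left S y fun x hx => hS (𝟙 _) x hx
  · obtain ⟨S, rfl⟩ := pointSubset_surjective S
    rw [← (isJoin_pointSubset_iff.1 hs).sSup_eq]
    exact h.sSup_right x S fun y hy => hS (𝟙 _) y hy

lemma isInternallyHausdorff_pointPresheaf_iff :
    IsInternallyHausdorff (pointPresheaf L) ↔ IsHausdorffFrame L := by
  refine ⟨fun h W hW h₀ => ?_, fun h c W hW h₀ => ?_⟩
  · obtain ⟨a, ha⟩ := h (pointRel ⟨⟨⟩⟩ W) (isProductOpen_pointRel_iff.2 hW) fun _ => h₀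
    exact ⟨a, ha (𝟙 _)⟩
  · obtain ⟨W, rfl⟩ := pointRel_surjective W
    obtain ⟨a, ha⟩ := h W (isProductOpen_pointRel_iff.1 hW) (h₀ (𝟙 c))
    exact ⟨a, fun _ => ha⟩

lemma isHausdorffFrame_iff_isRegularFrame (hL : IsCompactElement (⊤ : L)) :
    IsHausdorffFrame L ↔ IsRegularFrame L := by
  rw [← isInternallyHausdorff_pointPresheaf_iff, ← isInternallyRegular_pointPresheaf_iff]
  exact isInternallyHausdorff_iff_isInternallyRegular isInternalFrame_pointPresheaf
    (isInternallyCompact_pointPresheaf hL)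

end Point

/-! ### The internal frame of lax families -/

section LaxFamily

variable {C : Type u} [SmallCategory C] {A B : Cᵒᵖ ⥤ Frm.{u}} {a b : C}

variable (A a) in
/-- The sublattice of the families `(x_f)` with `A(g) x_f ≤ x_{fg}`: the lattice structure of
`Tilde (A ⋙ frmToPos) a`. -/
def laxFamilies : Sublattice (∀ b : C, (b ⟶ a) → A.obj (op b)) where
  carrier := {x | ∀ (b c : C) (g : c ⟶ b) (f : b ⟶ a), A.map g.op (x b f) ≤ x c (g ≫ f)}
  supClosed' _ hx _ hy b c g f := (map_sup (A.map g.op).hom _ _).trans_le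
    (sup_le_sup (hx b c g f) (hy b c g f))
  infClosed' _ hx _ hy b c g f := (map_inf (A.map g.op).hom _ _).trans_le
    (inf_le_inf (hx b c g f) (hy b c g f))

variable (A a) in
/-- The elements at `a` of the presheaf of lattices associated with a presheaf of frames. -/
abbrev LaxFamily : Type u := laxFamilies A a

namespace LaxFamily

instance : BoundedOrder (LaxFamily A a) where
  top := ⟨⊤, fun _ _ _ _ => le_top⟩
  le_top x := le_top (a := x.1)
  bot := ⟨⊥, fun _ _ g _ => (map_bot (A.map g.op).hom).le⟩
  bot_le x := bot_le (a := x.1)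

lemma ext {x y : LaxFamily A a} (h : ∀ {b : C} (f : b ⟶ a), x.1 b f = y.1 b f) : x = y :=
  Subtype.ext (funext fun _ => funext fun f => h f)

/-- The value of a family at the identity. -/
def val : BoundedLatticeHom (LaxFamily A a) (A.obj (op a)) where
  toFun x := x.1 a (𝟙 a)
  map_sup' _ _ := rfl
  map_inf' _ _ := rfl
  map_top' := rfl
  map_bot' := rfl

/-- The strict family `(A(f) x)_f`. -/
def const : BoundedLatticeHom (A.obj (op a)) (LaxFamily A a) where
  toFun x := ⟨fun _ f => A.map f.op x, fun b c g f => by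
    dsimp only
    rw [op_comp, Functor.map_comp, Frm.comp_apply]⟩
  map_sup' x y := ext fun f => map_sup (A.map f.op).hom x y
  map_inf' x y := ext fun f => map_inf (A.map f.op).hom x y
  map_top' := ext fun f => map_top (A.map f.op).hom
  map_bot' := ext fun f => map_bot (A.map f.op).hom

lemma val_const (x : A.obj (op a)) : val (const x) = x := by
  change A.map (𝟙 (op a)) x = x
  rw [A.map_id, Frm.id_apply]

lemma map_val_le (x : LaxFamily A a) (f : b ⟶ a) : A.map f.op (val x) ≤ x.1 b f := by
  simpa only [Category.comp_id] using! x.2 a b f (𝟙 a)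

lemma const_val_le (x : LaxFamily A a) : const (val x) ≤ x := fun _ f => map_val_le x f

lemma codisjoint_of_val {x y : LaxFamily A a} (h : Codisjoint (val x) (val y)) :
    Codisjoint x y :=
  (h.map const).mono (const_val_le x) (const_val_le y)

variable (A) in
/-- Reindexing of families along `f : b ⟶ a`. -/
def resHom (f : b ⟶ a) : BoundedLatticeHom (LaxFamily A a) (LaxFamily A b) where
  toFun x := ⟨fun c g => x.1 c (g ≫ f), fun c d h g => by
    simpa only [Category.assoc] using x.2 c d h (g ≫ f)⟩
  map_sup' _ _ := rfl
  map_inf' _ _ := rfl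
  map_top' := rfl
  map_bot' := rfl

lemma resHom_const (f : b ⟶ a) (x : A.obj (op a)) :
    resHom A f (const x) = const (A.map f.op x) :=
  ext fun g => by
    change A.map (g ≫ f).op x = A.map g.op (A.map f.op x)
    rw [op_comp, Functor.map_comp, Frm.comp_apply]

lemma val_resHom (f : b ⟶ a) (x : LaxFamily A a) : val (resHom A f x) = x.1 b f :=
  congrArg (x.1 b) (Category.id_comp f)

/-- The pointwise action of a morphism of presheaves of frames on families. -/
def mapHom (φ : A ⟶ B) (a : C) : BoundedLatticeHom (LaxFamily A a) (LaxFamily B a) where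
  toFun x := ⟨fun b f => φ.app (op b) (x.1 b f), fun b c g f =>
    (ConcreteCategory.congr_hom (φ.naturality g.op) (x.1 b f)).symm.trans_le
      (OrderHomClass.mono (φ.app (op c)).hom (x.2 b c g f))⟩
  map_sup' _ _ := ext fun {b} _ => map_sup (φ.app (op b)).hom _ _
  map_inf' _ _ := ext fun {b} _ => map_inf (φ.app (op b)).hom _ _
  map_top' := ext fun {b} _ => map_top (φ.app (op b)).hom
  map_bot' := ext fun {b} _ => map_bot (φ.app (op b)).hom

lemma mapHom_const (φ : A ⟶ B) (x : A.obj (op a)) :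
    mapHom φ a (const x) = const (φ.app (op a) x) :=
  ext fun f => ConcreteCategory.congr_hom (φ.naturality f.op) x

variable (A) in
/-- The presheaf of lattices of lax families. -/
def presheaf : Cᵒᵖ ⥤ BddDistLat.{u} where
  obj a := BddDistLat.of (LaxFamily A a.unop)
  map f := BddDistLat.ofHom (resHom A f.unop)
  map_id _ := BddDistLat.ext fun x => ext fun {b} f => congrArg (x.1 b) (Category.comp_id f)
  map_comp f g := BddDistLat.ext fun x => ext fun {b} h =>
    congrArg (x.1 b) (Category.assoc h g.unop f.unop).symm

/-- The morphism of presheaves of lattices induced by a morphism of presheaves of frames. -/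
def presheafMap (φ : A ⟶ B) : presheaf A ⟶ presheaf B where
  app a := BddDistLat.ofHom (mapHom φ a.unop)

/-- The values at the identities of the elements at stage `b` of a subset. -/
def values (S : SubsetAt (presheaf A) a) (f : b ⟶ a) : Set (A.obj (op b)) :=
  val '' (S.mem f : Set (LaxFamily A b))

lemma apply_mem_values {S : SubsetAt (presheaf A) a} {f : b ⟶ a} {x : LaxFamily A b}
    (hx : x ∈ S.mem f) {c : C} (g : c ⟶ b) : x.1 c g ∈ values S (g ≫ f) :=
  ⟨resHom A g x, S.mem_res f g hx, val_resHom g x⟩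

/-- The join of a subset of the presheaf of lax families. -/
def join (S : SubsetAt (presheaf A) a) : LaxFamily A a :=
  ⟨fun _ f => sSup (values S f), fun b c g f => by
    rw [map_sSup]
    refine sSup_le ?_
    rintro _ ⟨_, ⟨x, hx, rfl⟩, rfl⟩
    exact (map_val_le x g).trans (le_sSup (apply_mem_values hx g))⟩

lemma val_join (S : SubsetAt (presheaf A) a) : val (join S) = sSup (values S (𝟙 a)) := rfl

lemma isJoin_join (S : SubsetAt (presheaf A) a) : S.IsJoin (join S) := by
  refine ⟨fun f x hx c g => le_sSup (apply_mem_values hx g), fun f x hx c g => sSup_le ?_⟩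
  rintro _ ⟨y, hy, rfl⟩
  exact (hx g y hy c (𝟙 c)).trans_eq (val_resHom g x)

lemma values_meetWith (x : LaxFamily A a) (S : SubsetAt (presheaf A) a) (f : b ⟶ a) :
    values (S.meetWith x) f = (x.1 b f ⊓ ·) '' values S f := by
  have hval (y : LaxFamily A b) : val (resHom A f x ⊓ y) = x.1 b f ⊓ val y := by
    rw [map_inf, val_resHom]
  refine Set.Subset.antisymm ?_ ?_
  · rintro _ ⟨_, ⟨y, hy, rfl⟩, rfl⟩
    exact ⟨val y, ⟨y, hy, rfl⟩, (hval y).symm⟩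
  · rintro _ ⟨_, ⟨y, hy, rfl⟩, rfl⟩
    exact ⟨_, ⟨y, hy, rfl⟩, hval y⟩

variable (A) in
lemma isInternalFrame_presheaf : IsInternalFrame (presheaf A) where
  exists_join S := ⟨join S, isJoin_join S⟩
  meet_join {c} (x : LaxFamily A c) S s hs := by
    have hx : x ⊓ join S = join (S.meetWith x) := ext fun {b} f => by
      change x.1 b f ⊓ sSup (values S f) = sSup (values (S.meetWith x) f)
      rw [values_meetWith, sSup_image, inf_sSup_eq]
    rw [hs.unique (isJoin_join S)]
    exact (congrArg (SubsetAt.IsJoin _) hx).mpr (isJoin_join (S.meetWith x))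

lemma isInternallyCompact_presheaf (hA : ∀ a, IsCompactElement (⊤ : A.obj a)) :
    IsInternallyCompact (presheaf A) := by
  intro c S hS hjoin
  have hne : (values S (𝟙 c)).Nonempty := (hS (𝟙 c)).1.image _
  have hdir : DirectedOn (· ≤ ·) (values S (𝟙 c)) :=
    (hS (𝟙 c)).2.mono_comp (OrderHomClass.mono (val (A := A) (a := c)))
  have htop : sSup (values S (𝟙 c)) = ⊤ := by
    rw [← val_join, ← hjoin.unique (isJoin_join S)]
    exact map_top val
  obtain ⟨_, ⟨x, hx, rfl⟩, hval⟩ :=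
    exists_mem_codisjoint_of_sSup (z := ⊥) (hA (op c)) hne hdir (codisjoint_bot.2 htop)
  have hx_top : Codisjoint x ⊥ := codisjoint_of_val (by rwa [map_bot])
  rwa [codisjoint_bot.1 hx_top] at hx

lemma values_wellInside (x : LaxFamily A a) (f : b ⟶ a) :
    values (SubsetAt.wellInside (L := presheaf A) x) f = {z | WellInside z (x.1 b f)} := by
  rw [← val_resHom f x]
  refine Set.Subset.antisymm ?_ fun z hz => ?_
  · rintro _ ⟨y, hy, rfl⟩
    exact WellInside.map val hy
  · exact ⟨const z, (WellInside.map const hz).mono le_rfl (const_val_le _), val_const z⟩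

lemma isInternallyRegular_presheaf (hA : ∀ a, IsRegularFrame (A.obj a)) :
    IsInternallyRegular (presheaf A) := fun {c} (x : LaxFamily A c) => by
  have hx : x = join (SubsetAt.wellInside x) := ext fun {b} f => by
    change x.1 b f = sSup (values (SubsetAt.wellInside (L := presheaf A) x) f)
    rw [values_wellInside]
    exact hA (op b) (x.1 b f)
  exact (congrArg (SubsetAt.IsJoin _) hx).mpr (isJoin_join _)

lemma isJoin_image (φ : A ⟶ B) (S : SubsetAt (presheaf A) a) {s : LaxFamily A a}
    (hs : S.IsJoin s) : (S.image (presheafMap φ)).IsJoin (mapHom φ a s) := by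
  rw [hs.unique (isJoin_join S)]
  suffices h : mapHom φ a (join S) = join (S.image (presheafMap φ)) from h ▸ isJoin_join _
  refine ext fun {b} f => (map_sSup (φ.app (op b)).hom _).trans (congrArg sSup ?_)
  exact (Set.image_image _ _ _).trans (Set.image_image val (mapHom φ b) _).symm

end LaxFamily

end LaxFamily

/-! ### The equivalence for frames -/

section Equivalence

variable {C : Type u} [SmallCategory C]

lemma SubsetAt.IsJoin.image_iso {L M : Cᵒᵖ ⥤ BddDistLat.{u}} (i : L ≅ M) {c : C}
    {S : SubsetAt L c} {s : L.obj (op c)} (hs : S.IsJoin s) :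
    (S.image i.hom).IsJoin (i.hom.app (op c) s) := by
  have hom_mono (b : C) : Monotone (i.hom.app (op b)) := OrderHomClass.mono (i.hom.app (op b)).hom
  have inv_mono (b : C) : Monotone (i.inv.app (op b)) := OrderHomClass.mono (i.inv.app (op b)).hom
  have inv_hom {b : C} (x : L.obj (op b)) : i.inv.app (op b) (i.hom.app (op b) x) = x :=
    ConcreteCategory.congr_hom (i.hom_inv_id_app (op b)) x
  have hom_inv {b : C} (x : M.obj (op b)) : i.hom.app (op b) (i.inv.app (op b) x) = x :=
    ConcreteCategory.congr_hom (i.inv_hom_id_app (op b)) x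
  refine ⟨?_, fun {b} f x hx => ?_⟩
  · rintro b f _ ⟨y, hy, rfl⟩
    rw [← app_res]
    exact hom_mono b (hs.1 f y hy)
  · rw [← app_res, ← hom_inv x]
    refine hom_mono b (hs.2 f _ fun {d} g y hy => ?_)
    rw [← app_res, ← inv_hom y]
    exact inv_mono d (hx g _ ⟨y, hy, rfl⟩)

/-- An isomorphism of the underlying presheaves of lattices is an isomorphism of internal
frames. -/
def IntFrm.isoOfLatIso {L M : IntFrm C} (i : L.lat ≅ M.lat) : L ≅ M where
  hom := ⟨i.hom, fun _ _ h => h.image_iso i⟩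
  inv := ⟨i.inv, fun _ _ h => h.image_iso i.symm⟩
  hom_inv_id := IntFrm.Hom.ext i.hom_inv_id
  inv_hom_id := IntFrm.Hom.ext i.inv_hom_id

variable (C) in
/-- The functor `L ↦ C ∘ L` from internal compact regular frames to presheaves of compact regular
frames. -/
def completionFunctor : IntKRegFrm C ⥤ (Cᵒᵖ ⥤ KRegFrm.{u}) where
  obj L := ObjectProperty.lift _ (L.obj.lat ⋙ completionFrm) fun a =>
    ⟨Completion.isCompactElement_top, Completion.isRegularFrame
      (IsInternallyCompact.isNormalLattice L.property.1 L.property.2 a.unop)⟩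
  map φ :=
    { app := fun a => ObjectProperty.homMk (completionFrm.map (φ.hom.hom.app a))
      naturality := fun _ _ f => ObjectProperty.hom_ext _
        ((Functor.whiskerRight φ.hom.hom completionFrm).naturality f) }
  map_id L := by
    ext a : 2
    exact ObjectProperty.hom_ext _ (completionFrm.map_id (L.obj.lat.obj a))
  map_comp φ ψ := by
    ext a : 2
    exact ObjectProperty.hom_ext _
      (completionFrm.map_comp (φ.hom.hom.app a) (ψ.hom.hom.app a))

variable (C) in
/-- The functor `A ↦ Ã` from presheaves of compact regular frames to internal compact regular
frames. -/
def laxFamilyFunctor : (Cᵒᵖ ⥤ KRegFrm.{u}) ⥤ IntKRegFrm C where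
  obj A := ⟨⟨LaxFamily.presheaf (A ⋙ ObjectProperty.ι _), LaxFamily.isInternalFrame_presheaf _⟩,
    LaxFamily.isInternallyCompact_presheaf fun a => (A.obj a).property.1,
    LaxFamily.isInternallyRegular_presheaf fun a => (A.obj a).property.2⟩
  map φ := ObjectProperty.homMk
    ⟨LaxFamily.presheafMap (Functor.whiskerRight φ _), LaxFamily.isJoin_image _⟩

/-! ### The unit of the equivalence -/

section Unit

variable {L : Cᵒᵖ ⥤ BddDistLat.{u}} {c : C}

/-- The rounded ideal at the stage `b` of a family of rounded ideals. -/
def idealAt (I : LaxFamily (L ⋙ completionFrm) c) {b : C} (f : b ⟶ c) :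
    Completion (L.obj (op b)) :=
  I.1 b f

/-- A family of rounded ideals is lax precisely when it is an internal subset. -/
def familySubset (I : LaxFamily (L ⋙ completionFrm) c) : SubsetAt L c where
  mem f := {x | x ∈ (idealAt I f).1}
  mem_res {b d} f g x hx := I.2 b d g f ⟨x, hx, le_rfl⟩

lemma isDirected_familySubset (I : LaxFamily (L ⋙ completionFrm) c) :
    (familySubset I).IsDirected := fun f => ⟨(idealAt I f).1.nonempty, (idealAt I f).1.directed⟩

variable (hc : IsInternallyCompact L) (hr : IsInternallyRegular L)

/-- The family of the rounded ideals of elements well inside the restrictions of `x`. -/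
def belowFamily (x : L.obj (op c)) : LaxFamily (L ⋙ completionFrm) c :=
  ⟨fun b f => Completion.below (hc.isNormalLattice hr b) (res L f x), fun b d g f => by
    rintro y ⟨a, ha, hy⟩
    exact (WellInside.map (res L g) ha).mono hy (res_comp L g f x).ge⟩

lemma belowFamily_of_isJoin (I : LaxFamily (L ⋙ completionFrm) c) {s : L.obj (op c)}
    (hs : (familySubset I).IsJoin s) : belowFamily hc hr s = I :=
  LaxFamily.ext fun {b} f =>
    Completion.below_eq (hN := hc.isNormalLattice hr b) (hs.1 f) fun _ hz =>
      let ⟨x, hx, hxz⟩ := hc.exists_mem_codisjoint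
        (SubsetAt.IsDirected.restrict (isDirected_familySubset I) f) (hs.restrict f) hz
      ⟨x, SubsetAt.mem_restrict_id.1 hx, hxz⟩

/-- An internal compact regular frame is isomorphic to its frame of rounded ideals. -/
noncomputable def belowFamilyIso (hF : IsInternalFrame L) (c : C) :
    L.obj (op c) ≃o LaxFamily (L ⋙ completionFrm) c where
  toFun := belowFamily hc hr
  invFun I := (hF.exists_join (familySubset I)).choose
  left_inv x := (hF.exists_join (familySubset (belowFamily hc hr x))).choose_spec.unique (hr x)
  right_inv I := belowFamily_of_isJoin hc hr I (hF.exists_join (familySubset I)).choose_spec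
  map_rel_iff' {x y} := by
    refine ⟨fun h => (hr x).le fun {b} f a ha => WellInside.le (h b f ha), fun h b f a ha => ?_⟩
    exact WellInside.mono ha le_rfl (OrderHomClass.mono (res L f) h)

/-- The presheaf version of `belowFamilyIso`. -/
noncomputable def belowPresheafIso (hF : IsInternalFrame L) :
    L ≅ LaxFamily.presheaf (L ⋙ completionFrm) :=
  NatIso.ofComponents (fun a => BddDistLat.Iso.mk (belowFamilyIso hc hr hF a.unop)) fun f =>
    BddDistLat.ext fun x => LaxFamily.ext fun {b} g =>
      congrArg (Completion.below (hc.isNormalLattice hr b)) (res_comp L g f.unop x).symm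

lemma IntFrm.Hom.map_below {L M : IntFrm C} (φ : L.Hom M) (hr : IsInternallyRegular L.lat)
    (hM : IsInternallyCompact M.lat) {hN : IsNormalLattice (L.lat.obj (op c))}
    {hN' : IsNormalLattice (M.lat.obj (op c))} (x : L.lat.obj (op c)) :
    Completion.map (φ.hom.app (op c)).hom (Completion.below hN x) =
      Completion.below hN' (φ.hom.app (op c) x) := by
  refine Completion.map_below fun z hz => ?_
  obtain ⟨_, ⟨y, hy, rfl⟩, hyz⟩ := hM.exists_mem_codisjoint
    (SubsetAt.IsDirected.image (SubsetAt.isDirected_wellInside x) φ.hom)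
    (φ.map_join _ x (hr x)) hz
  exact ⟨y, SubsetAt.mem_wellInside_id.1 hy, hyz⟩

lemma belowFamily_app {L M : IntFrm C} (φ : L.Hom M) (hL : IsInternallyCompact L.lat)
    (hL' : IsInternallyRegular L.lat) (hM : IsInternallyCompact M.lat)
    (hM' : IsInternallyRegular M.lat) (x : L.lat.obj (op c)) :
    belowFamily hM hM' (φ.hom.app (op c) x) =
      LaxFamily.mapHom (Functor.whiskerRight φ.hom completionFrm) c (belowFamily hL hL' x) :=
  LaxFamily.ext fun {b} f =>
    (congrArg (Completion.below (hM.isNormalLattice hM' b)) (app_res φ.hom f x).symm).trans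
      (φ.map_below hL' hM (hN := hL.isNormalLattice hL' b) (res L.lat f x)).symm

end Unit

variable (C) in
/-- The unit of the equivalence. -/
noncomputable def belowNatIso : 𝟭 (IntKRegFrm C) ≅ completionFunctor C ⋙ laxFamilyFunctor C :=
  NatIso.ofComponents
    (fun L => ObjectProperty.isoMk _ (IntFrm.isoOfLatIso
      (belowPresheafIso L.property.1 L.property.2 L.obj.isFrame))) fun {L M} φ =>
    ObjectProperty.hom_ext _ (IntFrm.Hom.ext (NatTrans.ext (funext fun _ => BddDistLat.ext
      (belowFamily_app φ.hom L.property.1 L.property.2 M.property.1 M.property.2))))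

/-! ### The counit of the equivalence -/

section Counit

variable {A B : Cᵒᵖ ⥤ Frm.{u}} {a b : C}

/-- The isomorphism `A(a) ≃ C(Ã(a))`, which sends `x` to the rounded ideal generated by the strict
families of the elements well inside `x`. -/
def constBelowIso (hc : IsCompactElement (⊤ : A.obj (op a))) (hr : IsRegularFrame (A.obj (op a))) :
    A.obj (op a) ≃o Completion (LaxFamily A a) :=
  (Completion.belowIso hc hr).trans (Completion.orderIsoOfCoreflection LaxFamily.const
    LaxFamily.val LaxFamily.val_const LaxFamily.const_val_le)

/-- The strict families being preserved by reindexing and by morphisms of presheaves, this gives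
both the naturality in `a` and the naturality in `A`. -/
lemma map_constBelowIso {hc : IsCompactElement (⊤ : A.obj (op a))}
    {hr : IsRegularFrame (A.obj (op a))} {hc' : IsCompactElement (⊤ : B.obj (op b))}
    {hr' : IsRegularFrame (B.obj (op b))} (f : FrameHom (A.obj (op a)) (B.obj (op b)))
    (g : BoundedLatticeHom (LaxFamily A a) (LaxFamily B b))
    (hfg : ∀ x, g (LaxFamily.const x) = LaxFamily.const (f x)) (x : A.obj (op a)) :
    Completion.map g (constBelowIso hc hr x) = constBelowIso hc' hr' (f x) := by
  let f' : BoundedLatticeHom (A.obj (op a)) (B.obj (op b)) := f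
  have hcomp : g.comp LaxFamily.const = LaxFamily.const.comp f' := BoundedLatticeHom.ext hfg
  have hbelow := Completion.frameHom_map_below hr hc' f (hN := hr.isNormalLattice hc)
    (hN' := hr'.isNormalLattice hc') x
  calc Completion.map g (Completion.map LaxFamily.const (Completion.belowIso hc hr x))
      = Completion.map LaxFamily.const (Completion.map f' (Completion.belowIso hc hr x)) := by
        rw [← Completion.map_comp, hcomp, Completion.map_comp]
    _ = Completion.map LaxFamily.const (Completion.belowIso hc' hr' (f x)) :=
        congrArg (Completion.map LaxFamily.const) hbelow

lemma resHom_constBelowIso {hc : IsCompactElement (⊤ : A.obj (op a))}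
    {hr : IsRegularFrame (A.obj (op a))} {hc' : IsCompactElement (⊤ : A.obj (op b))}
    {hr' : IsRegularFrame (A.obj (op b))} (f : b ⟶ a) (x : A.obj (op a)) :
    Completion.map (LaxFamily.resHom A f) (constBelowIso hc hr x) =
      constBelowIso hc' hr' (A.map f.op x) :=
  map_constBelowIso (A.map f.op).hom _ (LaxFamily.resHom_const f) x

lemma mapHom_constBelowIso {hc : IsCompactElement (⊤ : A.obj (op a))}
    {hr : IsRegularFrame (A.obj (op a))} {hc' : IsCompactElement (⊤ : B.obj (op a))}
    {hr' : IsRegularFrame (B.obj (op a))} (φ : A ⟶ B) (x : A.obj (op a)) :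
    Completion.map (LaxFamily.mapHom φ a) (constBelowIso hc hr x) =
      constBelowIso hc' hr' (φ.app (op a) x) :=
  map_constBelowIso (φ.app (op a)).hom _ (LaxFamily.mapHom_const φ) x

end Counit

variable (C) in
/-- The counit of the equivalence, in the direction `A ≅ C ∘ Ã`. -/
def constBelowNatIso :
    𝟭 (Cᵒᵖ ⥤ KRegFrm.{u}) ≅ laxFamilyFunctor C ⋙ completionFunctor C :=
  NatIso.ofComponents
    (fun A => NatIso.ofComponents
      (fun a => ObjectProperty.isoMk _ (Frm.Iso.mk (constBelowIso (A := A ⋙ ObjectProperty.ι _)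
        (A.obj a).property.1 (A.obj a).property.2)))
      fun f => ObjectProperty.hom_ext _ (Frm.ext fun x =>
        (resHom_constBelowIso (A := A ⋙ ObjectProperty.ι _) f.unop x).symm))
    fun φ => NatTrans.ext (funext fun a => ObjectProperty.hom_ext _ (Frm.ext fun x =>
      (mapHom_constBelowIso (Functor.whiskerRight φ (ObjectProperty.ι _)) (a := a.unop) x).symm))

variable (C) in
/-- Internal compact regular frames are presheaves of compact regular frames. -/
noncomputable def kRegFrmEquivalence : IntKRegFrm C ≌ (Cᵒᵖ ⥤ KRegFrm.{u}) :=
  .mk (completionFunctor C) (laxFamilyFunctor C) (belowNatIso C) (constBelowNatIso C).symm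

end Equivalence

/-! ### Compact Hausdorff locales -/

/-- Compact Hausdorff locales are dual to compact regular frames. -/
def kRegFrmOpEquivalence : KRegFrm.{u}ᵒᵖ ≌ KHausLoc.{u} where
  functor :=
    { obj L := ⟨op L.unop.obj, L.unop.property.1,
        (isHausdorffFrame_iff_isRegularFrame L.unop.property.1).2 L.unop.property.2⟩
      map f := ObjectProperty.homMk (Quiver.Hom.op (V := Frm.{u}) f.unop.hom) }
  inverse :=
    { obj X := op ⟨X.obj.unop, X.property.1,
        (isHausdorffFrame_iff_isRegularFrame X.property.1).1 X.property.2⟩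
      map f := (ObjectProperty.homMk (Quiver.Hom.unop (V := Frm.{u}) f.hom)).op }
  unitIso := Iso.refl _
  counitIso := Iso.refl _

/-- Internal compact Hausdorff locales are dual to internal compact regular frames. -/
def intKHausLocEquivalence (C : Type u) [SmallCategory C] :
    IntKHausLoc C ≌ (IntKRegFrm C)ᵒᵖ where
  functor :=
    { obj X := op ⟨X.obj.unop, X.property.1, (isInternallyHausdorff_iff_isInternallyRegular
        X.obj.unop.isFrame X.property.1).1 X.property.2⟩
      map f := (ObjectProperty.homMk f.hom.unop).op }
  inverse :=
    { obj L := ⟨op L.unop.obj, L.unop.property.1, (isInternallyHausdorff_iff_isInternallyRegular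
        L.unop.obj.isFrame L.unop.property.1).2 L.unop.property.2⟩
      map f := ObjectProperty.homMk f.unop.hom.op }
  unitIso := Iso.refl _
  counitIso := Iso.refl _

/-- Internal compact Hausdorff locales are functors to compact Hausdorff locales. -/
noncomputable def kHausLocEquivalence (C : Type u) [SmallCategory C] :
    IntKHausLoc C ≌ (C ⥤ KHausLoc.{u}) :=
  (intKHausLocEquivalence C).trans ((kRegFrmEquivalence C).op.trans
    ((Functor.leftOpRightOpEquiv C KRegFrm.{u}).trans (kRegFrmOpEquivalence.congrRight)))

end PresheafFrame

theorem mainTheorem1 (C : Type u) [SmallCategory C] :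
    (∃ e : PresheafFrame.IntKRegFrm C ≌ (Cᵒᵖ ⥤ PresheafFrame.KRegFrm.{u}),
      Nonempty (e.functor ⋙ (Functor.whiskeringRight Cᵒᵖ _ _).obj PresheafFrame.KRegFrm.toPos ≅
        PresheafFrame.IntKRegFrm.toLat C ⋙
          (Functor.whiskeringRight Cᵒᵖ _ _).obj PresheafFrame.completion) ∧
      Nonempty (e.inverse ⋙ PresheafFrame.IntKRegFrm.toLat C ⋙
          (Functor.whiskeringRight Cᵒᵖ _ _).obj PresheafFrame.latToPos ≅
        (Functor.whiskeringRight Cᵒᵖ _ _).obj PresheafFrame.KRegFrm.toPos ⋙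
          PresheafFrame.tilde C)) ∧
    (∃ e : PresheafFrame.IntKHausLoc C ≌ (C ⥤ PresheafFrame.KHausLoc.{u}),
      Nonempty (e.functor ⋙ (Functor.whiskeringRight C _ _).obj PresheafFrame.KHausLoc.opens ≅
        PresheafFrame.IntKHausLoc.opens C ⋙
          ((Functor.whiskeringRight Cᵒᵖ _ _).obj PresheafFrame.completion).op ⋙
          (Functor.leftOpRightOpEquiv C PartOrd.{u}).functor) ∧
      Nonempty (e.inverse ⋙ PresheafFrame.IntKHausLoc.opens C ⋙
          ((Functor.whiskeringRight Cᵒᵖ _ _).obj PresheafFrame.latToPos).op ≅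
        (Functor.whiskeringRight C _ _).obj PresheafFrame.KHausLoc.opens ⋙
          (Functor.leftOpRightOpEquiv C PartOrd.{u}).inverse ⋙
          (PresheafFrame.tilde C).op)) :=
  -- On underlying posets the four functors are definitionally the two constructions.
  ⟨⟨PresheafFrame.kRegFrmEquivalence C, ⟨Iso.refl _⟩, ⟨Iso.refl _⟩⟩,
    ⟨PresheafFrame.kHausLocEquivalence C, ⟨Iso.refl _⟩, ⟨Iso.refl _⟩⟩⟩
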